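/- Let $W\subset\mathbb R^2$ be a bounded convex set with non-empty interior. Lines of the plane are parametrised by $(\alpha,p)\in[0,\pi)\times\mathbb R$, the line $D(p,\alpha)$ being $\{x : x_1\cos\alpha+x_2\sin\alpha=p\}$. Let $D_W$ be the set of those $(\alpha,p)$ for which $D(p,\alpha)$ intersects $W$. For $\tau\ge 0$, let $\lambda_W^\tau$ be the law of the Poisson line process of intensity $\tau$ restricted to $W$: a random finite set of lines whose number of lines is a Poisson variable of parameter $\tau$ and which, given their number, are independent with the uniform distribution (normalised Lebesgue measure) on $D_W$. A T-tessellation $T$ of $W$ is a tessellation of $W$ into finitely many polygonal cells all of whose inner vertices are T-shaped and no two of whose segments are aligned. It is described by its segments: $T$ is a finite (possibly empty) set of non-degenerate closed segments, whose insides (the segments without their endpoints) lie in the interior of $W$, no two of which are supported by the same line, and such that every vertex $x$ in the interior of $W$ (every endpoint of a segment and every common point of two segments) belongs to the inside of exactly one segment and is an endpoint of exactly one segment. Denote by $L(T)$ the finite set of lines that support the segments of $T$, and by $\mathcal T_W$ the set of T-tessellations of $W$. Finite sets of lines and finite sets of segments carry the usual $\sigma$-algebra of finite point configurations (a set $S$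 of configurations is measurable if for every $k$ the set of $k$-tuples $(x_1,\dots,x_k)$ with $\{x_1,\dots,x_k\}\in S$ is Borel), and $\mathcal T_W$ carries the $\sigma$-algebra induced by the second one. Theorem. Let $C\in\mathbb R$ and let $H:\mathcal T_W\to\mathbb R$ be a measurable function (the energy) such that $H(T)\ge -C\,\#L(T)$ for every $T\in\mathcal T_W$. Then for every intensity $\tau\ge 0$ the Gibbs measure $$\mathrm d\gamma_W(T)=\exp(-H(T))\,\mathrm d\lambda_W^\tau(L(T))$$ on $\mathcal T_W$ is well-defined and finite. That is: the map sending a finite set of lines $L$ to the counting measure on $\{T\in\mathcal T_W: L(T)=L\}$ is $\lambda_W^\tau$-almost everywhere measurable, so that $$\gamma_W(A)=\int \sum_{T\in A,\ L(T)=L} e^{-H(T)}\;\mathrm d\lambda_W^\tau(L)\qquad (A\subseteq\mathcal T_W\text{ measurable})$$ defines a measure on $\mathcal T_W$, and $\gamma_W(\mathcal T_W)<\infty$. -/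

import Mathlib

open MeasureTheory
open scoped NNReal ENNReal

/-! ### Finite configurations of points -/

/-- A finite set of points of `α`. The wrapper only serves to carry the sigma-algebra of finite
point configurations given below, which differs from the sigma-algebra of `Finset α`. -/
@[ext]
structure FinConfig (α : Type*) where
  /-- the points of the configuration -/
  points : Finset α

namespace FinConfig

open Classical in
/-- The configuration `{x₁, …, x_k}` of the values of a `k`-tuple. -/
noncomputable def ofTuple {α : Type*} {k : ℕ} (x : Fin k → α) : FinConfig α :=
  ⟨Finset.univ.image x⟩

/-- The sigma-algebra of finite point configurations: a set `S` of configurations is measurable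
when, for every `k`, the set of `k`-tuples `(x₁, …, x_k)` with `{x₁, …, x_k} ∈ S` is measurable in
the product space `α^k`. -/
noncomputable instance instMeasurableSpace {α : Type*} [MeasurableSpace α] : MeasurableSpace (FinConfig α) :=
  ⨅ k : ℕ, MeasurableSpace.map (ofTuple (k := k)) MeasurableSpace.pi

theorem measurable_ofTuple {α : Type*} [MeasurableSpace α] (k : ℕ) :
    Measurable (ofTuple (α := α) (k := k)) := fun _ hS =>
  MeasurableSpace.measurableSet_iInf.1 hS k

end FinConfig

/-! ### Lines and the Poisson line process -/

/-- The Euclidean plane. -/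
abbrev Plane := EuclideanSpace ℝ (Fin 2)

/-- A pair `(α, p)` stands for the line `D(p, α)`, orthogonal at the point `P` of polar coordinates
`(p, α)` to the direction of angle `α`. Every line has exactly one such pair with `0 ≤ α < π`. -/
abbrev LineParam := ℝ × ℝ

/-- The point of abscissa `t` on the line `D(p, α)`, that is
`p (cos α, sin α) + t (-sin α, cos α)`. -/
noncomputable def linePoint (l : LineParam) (t : ℝ) : Plane :=
  !₂[l.2 * Real.cos l.1 - t * Real.sin l.1, l.2 * Real.sin l.1 + t * Real.cos l.1]

/-- The set `D_W ⊆ [0, π) × ℝ` of lines that intersect `W`. -/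
def hittingLines (W : Set Plane) : Set LineParam :=
  {l | l.1 ∈ Set.Ico 0 Real.pi ∧ ∃ t : ℝ, linePoint l t ∈ W}

/-- The law `λ_W^τ` of the Poisson line process restricted to `W`, where `τ` is the expected number
of lines: the number of lines is Poisson with parameter `τ`, and given that number the lines are
independent with the uniform law (normalised Lebesgue measure) on `D_W`. -/
noncomputable def poissonLines (W : Set Plane) (τ : ℝ≥0) : Measure (FinConfig LineParam) :=
  Measure.sum fun k : ℕ => ProbabilityTheory.poissonMeasure τ {k} •
    (Measure.pi fun _ : Fin k =>
      ProbabilityTheory.cond (volume : Measure LineParam) (hittingLines W)).map FinConfig.ofTuple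

/-! ### T-tessellations -/

/-- A pair `(l, (b, d))` stands for the segment of the line `l` between the abscissas `b`
and `d`. -/
abbrev SegParam := LineParam × ℝ × ℝ

namespace SegParam

/-- The closed segment. -/
def carrier (s : SegParam) : Set Plane := linePoint s.1 '' Set.Icc s.2.1 s.2.2

/-- The segment without its endpoints. -/
def inside (s : SegParam) : Set Plane := linePoint s.1 '' Set.Ioo s.2.1 s.2.2

/-- The two endpoints. -/
def ends (s : SegParam) : Set Plane := {linePoint s.1 s.2.1, linePoint s.1 s.2.2}

end SegParam

/-- `x` is a vertex of the drawing made of the segments in `S`: an endpoint of a segment or a common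
point of two segments. -/
def IsVertex (S : Finset SegParam) (x : Plane) : Prop :=
  (∃ s ∈ S, x ∈ s.ends) ∨ ∃ s ∈ S, ∃ m ∈ S, s ≠ m ∧ x ∈ s.carrier ∧ x ∈ m.carrier

/-- `x` is T-shaped: exactly one segment of `S` has `x` in its inside (it provides two aligned edges
at `x`) and exactly one segment of `S` ends at `x` (it provides the third edge). -/
def IsTShaped (S : Finset SegParam) (x : Plane) : Prop :=
  (∃! m : SegParam, m ∈ S ∧ x ∈ m.inside) ∧ ∃! s : SegParam, s ∈ S ∧ x ∈ s.ends

/-- A T-tessellation of a convex set `W`, given by its segments; the cells are the connected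
components of the complement of the segments in the interior of `W`. -/
@[ext]
structure TTessellation (W : Set Plane) where
  /-- the segments of the tessellation -/
  segments : Finset SegParam
  /-- every line is given by its parameters with angle in `[0, π)` -/
  angle_mem : ∀ s ∈ segments, s.1.1 ∈ Set.Ico 0 Real.pi
  /-- segments are nondegenerate -/
  birth_lt_death : ∀ s ∈ segments, s.2.1 < s.2.2
  /-- segments lie in the interior of `W`, except possibly for their endpoints -/
  inside_subset : ∀ s ∈ segments, s.inside ⊆ interior W
  /-- no two segments are aligned -/
  not_aligned : ∀ s ∈ segments, ∀ m ∈ segments, s.1 = m.1 → s = m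
  /-- all inner vertices are T-shaped -/
  tShaped : ∀ x ∈ interior W, IsVertex segments x → IsTShaped segments x

namespace TTessellation

variable {W : Set Plane}

open Classical in
/-- `L(T)`, the set of lines that support the segments of `T`. -/
noncomputable def lines (T : TTessellation W) : FinConfig LineParam :=
  ⟨T.segments.image Prod.fst⟩

/-- The sigma-algebra on T-tessellations, seen as finite configurations of segments. -/
noncomputable instance instMeasurableSpace : MeasurableSpace (TTessellation W) :=
  MeasurableSpace.comap (fun T => (⟨T.segments⟩ : FinConfig SegParam)) inferInstance

end TTessellation

/-- The counting measure on the T-tessellations `T` such that `L(T) = L`. -/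
noncomputable def tessellationsOn (W : Set Plane) (L : FinConfig LineParam) :
    Measure (TTessellation W) :=
  Measure.sum fun T : {T : TTessellation W // T.lines = L} => Measure.dirac T.1

/-- The reference measure `dλ_W^τ(L(T))` on T-tessellations:
`∫ F(T) dλ_W^τ(L(T)) = ∫ ∑_{T : L(T) = L} F(T) dλ_W^τ(L)`. -/
noncomputable def tessellationMeasure (W : Set Plane) (τ : ℝ≥0) : Measure (TTessellation W) :=
  (poissonLines W τ).bind (tessellationsOn W)

/-- The Gibbs measure `dγ_W(T) = exp(-H(T)) dλ_W^τ(L(T))`. -/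
noncomputable def gibbsMeasure (W : Set Plane) (τ : ℝ≥0) (H : TTessellation W → ℝ) :
    Measure (TTessellation W) :=
  (tessellationMeasure W τ).withDensity fun T => ENNReal.ofReal (Real.exp (-H T))

/-! A Poisson number of lines gives `k` lines a weight of order `1 / k!`, and the energy costs at
most `exp |C| ^ k`. Finiteness thus reduces to a count: the T-tessellations supported by `k` lines
with distinct directions (almost surely the case, `ae_pi_fst_injective`) must be fewer than `k!` by
more than any exponential factor. Choosing freely the lines on which the segments end gives only `(k
+ 1) ^ (2 * k)`.

Sweep the plane away from one of the lines, on both sides. The tessellation is determined by the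
segment on that line, by which segments are absent or present at time zero on each side, and by two
integers per segment and side: its birth rank (how many segments its line has met up to its birth)
and the number of segments that die on it. Indeed, look at the first time at which two tessellations
with the same data differ. If one of them delays a birth, the line concerned meets one more segment
before it; if one of them delays a death, the surviving segment kills one more. This is
`IsSweep.eq_of_ranks`. The numbers of kills add up to at most `k`, so they cost only a factor `4 ^
k` per side.

The ranks are the expensive data, and the choice of the line controls them. Sweep from a line that
meets the largest number `m` of segments. Every rank is then at most `m`, and the `m` segments met
by that line need no rank, since none of them is born at a positive time. This leaves about `(m + 1)
^ (k - m)` sequences of ranks, whence `ncard_tessTuples_le`. After division by `k!`, summing over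
`k` first gives `exp (R * (m + 1)) / (m + 1) ^ m`, which is summable in `m`.

For measurability, each end of a segment is either on another line or where its own line crosses the
boundary of `W`. The tessellations on given lines are therefore among finitely many candidates that
depend measurably on the lines (`measurable_tessellationsOn`). -/

/-! ### Sweeping a half-plane -/

/-- The state of a tessellation in a half-plane that is swept by lines parallel to its border. The
segment of index `i` is there at the times in `[β i, δ i]`; it is absent if `β i = δ i = 0`. The
relation `M i j t` says that the lines `i` and `j` meet at time `t`, and `U i` is the set of the
times at which the line `i` is in the interior of the domain. -/
structure IsSweep {ι : Type*} (M : ι → ι → ℝ → Prop) (U : ι → Set ℝ) (β δ : ι → ℝ) : Prop where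
  nonneg : ∀ i, 0 ≤ β i
  lt_or_absent : ∀ i, β i < δ i ∨ (β i = 0 ∧ δ i = 0)
  Ioo_subset : ∀ i, Set.Ioo (β i) (δ i) ⊆ U i
  meet : ∀ i j t, 0 < t → M i j t → t ∈ U i → t ∈ Set.Icc (β i) (δ i) → t ∈ Set.Icc (β j) (δ j) →
    (t ∈ Set.Ioo (β i) (δ i) ∧ (t = β j ∨ t = δ j)) ∨
    (t ∈ Set.Ioo (β j) (δ j) ∧ (t = β i ∨ t = δ i))
  birth : ∀ i, 0 < β i → β i ∈ U i → ∃ j, M i j (β i) ∧ β i ∈ Set.Ioo (β j) (δ j)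
  death : ∀ i, 0 < δ i → δ i ∈ U i → ∃ j, M i j (δ i) ∧ δ i ∈ Set.Ioo (β j) (δ j)
  host_unique : ∀ i i' j, M i j (δ j) → M i' j (δ j) → δ j ∈ U j →
    δ j ∈ Set.Ioo (β i) (δ i) → δ j ∈ Set.Ioo (β i') (δ i') → i = i'

/-! ### Reconstruction of a sweep from its ranks and kill numbers -/

section Sweep

variable {ι : Type*} [Fintype ι]

open Classical in
/-- The number of segments met by the line `i` until the birth of its segment. -/
noncomputable def birthRank (M : ι → ι → ℝ → Prop) (U : ι → Set ℝ) (β δ : ι → ℝ) (i : ι) : ℕ :=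
  (Finset.univ.filter fun j =>
    ∃ t ∈ Set.Ioc 0 (β i), M i j t ∧ t ∈ U i ∧ t ∈ Set.Icc (β j) (δ j)).card

open Classical in
/-- The number of segments that die on the segment `i`. -/
noncomputable def killCount (M : ι → ι → ℝ → Prop) (U : ι → Set ℝ) (β δ : ι → ℝ) (i : ι) : ℕ :=
  (Finset.univ.filter fun j => M i j (δ j) ∧ δ j ∈ U j ∧ δ j ∈ Set.Ioo (β i) (δ i)).card

variable {M : ι → ι → ℝ → Prop} {U : ι → Set ℝ} {β δ β' δ' : ι → ℝ}

theorem birthRank_eq_zero {i : ι} (h : β i = 0) : birthRank M U β δ i = 0 := by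
  simp [birthRank, h]

/-- Since the host of a death is unique, the sets of segments killed by distinct segments are
disjoint. -/
theorem IsSweep.sum_killCount_le (h : IsSweep M U β δ) :
    ∑ i, killCount M U β δ i ≤ Fintype.card ι := by
  classical
  unfold killCount
  rw [← Finset.card_biUnion]
  · exact Finset.card_le_univ _
  · intro i _ i' _ hne
    refine Finset.disjoint_left.2 fun j hj hj' => hne ?_
    simp only [Finset.mem_filter, Finset.mem_univ, true_and] at hj hj'
    exact h.host_unique i i' j hj.1 hj'.1 hj.2.1 hj.2.2 hj'.2.2

/-- Two sweeps that have the same births and deaths before time `t` have the same births at time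
`t` when the birth ranks are the same. -/
theorem IsSweep.birth_not_lt (h : IsSweep M U β δ) (h' : IsSweep M U β' δ')
    (hM : ∀ i j s t, M i j s → M i j t → s = t) (hU : ∀ i, (U i).OrdConnected) {t : ℝ} (ht : 0 < t)
    (hβ : ∀ i, β i = β' i ∨ (t ≤ β i ∧ t ≤ β' i)) (hδ : ∀ i, δ i = δ' i ∨ (t ≤ δ i ∧ t ≤ δ' i))
    {i : ι} (hr : birthRank M U β δ i = birthRank M U β' δ' i) (hi : β i = t) : ¬ t < β' i := by
  classical
  intro hlt
  have hl : β i < δ i := by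
    rcases h.lt_or_absent i with h1 | h1
    · exact h1
    · linarith [h1.1]
  have hl' : β' i < δ' i := by
    rcases h'.lt_or_absent i with h1 | h1
    · exact h1
    · linarith [h1.1]
  -- The line is in the domain just after `t` (first sweep) and just after `β' i` (second sweep),
  -- hence at `β' i` by convexity. The delayed birth is thus an inner one and has a host.
  have hmem : β' i ∈ U i := by
    obtain ⟨u, hu1, hu2⟩ := exists_between (lt_min (hi ▸ hl) hlt)
    obtain ⟨v, hv1, hv2⟩ := exists_between hl'
    exact (hU i).out (h.Ioo_subset i ⟨hi ▸ hu1, hu2.trans_le (min_le_left _ _)⟩)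
      (h'.Ioo_subset i ⟨hv1, hv2⟩) ⟨(hu2.trans_le (min_le_right _ _)).le, hv1.le⟩
  obtain ⟨j, hj, hj'⟩ := h'.birth i (ht.trans hlt) hmem
  refine hr.not_lt (Finset.card_lt_card ((Finset.ssubset_iff_of_subset ?_).2 ⟨j, ?_, ?_⟩))
  · intro a ha
    simp only [Finset.mem_filter, Finset.mem_univ, true_and] at ha ⊢
    obtain ⟨s, ⟨hs0, hs⟩, hM', hsU, hs1, hs2⟩ := ha
    rw [hi] at hs
    refine ⟨s, ⟨hs0, hs.trans hlt.le⟩, hM', hsU, ?_⟩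
    -- A segment met exactly at time `t = β i` contains the meeting point in its inside, so it was
    -- born earlier, where the two sweeps agree.
    have hlta : β a < t := by
      rcases hs.lt_or_eq with h1 | h1
      · exact hs1.trans_lt h1
      · rcases h.meet i a s hs0 hM' hsU ⟨by linarith, by linarith⟩ ⟨hs1, hs2⟩ with h2 | h2
        · exact absurd h2.1.1 (by linarith)
        · exact h1 ▸ h2.1.1
    constructor
    · rcases hβ a with h1 | h1
      · exact h1 ▸ hs1
      · exact absurd h1.1 (not_le.2 hlta)
    · rcases hδ a with h1 | h1
      · exact h1 ▸ hs2
      · exact hs.trans h1.2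
  · simp only [Finset.mem_filter, Finset.mem_univ, true_and]
    exact ⟨β' i, ⟨ht.trans hlt, le_rfl⟩, hj, hmem, hj'.1.le, hj'.2.le⟩
  · simp only [Finset.mem_filter, Finset.mem_univ, true_and]
    -- The lines `i` and `j` meet only once, at time `β' i > t`, so the new host is not counted in
    -- the first sweep.
    rintro ⟨s, ⟨hs0, hs⟩, hM', -⟩
    have := hM _ _ _ _ hM' hj
    linarith

/-- Two sweeps that have the same births and deaths before time `t` have the same deaths at time
`t` when the numbers of kills are the same. -/
theorem IsSweep.death_not_lt (h : IsSweep M U β δ) (h' : IsSweep M U β' δ') {t : ℝ} (ht : 0 < t)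
    (hβ : ∀ i, β i = β' i ∨ (t ≤ β i ∧ t ≤ β' i)) (hδ : ∀ i, δ i = δ' i ∨ (t ≤ δ i ∧ t ≤ δ' i))
    {i : ι} (hw : killCount M U β δ i = killCount M U β' δ' i) (hi : δ i = t) : ¬ t < δ' i := by
  classical
  intro hlt
  have hl : β i < t := by
    rcases h.lt_or_absent i with h1 | h1
    · exact hi ▸ h1
    · linarith [h1.2]
  have early : ∀ a, β a < t → β a = β' a := fun a ha => by
    rcases hβ a with h1 | h1
    · exact h1
    · exact absurd h1.1 (not_le.2 ha)
  have htmem : t ∈ Set.Ioo (β' i) (δ' i) := ⟨early i hl ▸ hl, hlt⟩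
  have htU : t ∈ U i := h'.Ioo_subset i htmem
  obtain ⟨j, hj, hj1, hj2⟩ := h.death i (hi ▸ ht) (hi ▸ htU)
  rw [hi] at hj hj1 hj2
  have hj1' : β' j < t := early j hj1 ▸ hj1
  have hj2' : t ≤ δ' j := by
    rcases hδ j with h1 | h1
    · exact h1 ▸ hj2.le
    · exact h1.2
  -- In the second sweep `i` goes through the point where it died on `j` in the first. Both segments
  -- are there, so the vertex can be T-shaped only if `j` ends on `i`; as `j` was born earlier, it
  -- dies there. This is the extra kill.
  have hjt : t = δ' j := by
    rcases h'.meet i j t ht hj htU ⟨htmem.1.le, htmem.2.le⟩ ⟨hj1'.le, hj2'⟩ with h1 | h1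
    · rcases h1.2 with h2 | h2
      · exact absurd h2 hj1'.ne'
      · exact h2
    · rcases h1.2 with h2 | h2
      · exact absurd h2 htmem.1.ne'
      · exact absurd h2 htmem.2.ne
  have hjU : t ∈ U j := h.Ioo_subset j ⟨hj1, hj2⟩
  refine hw.not_lt (Finset.card_lt_card ((Finset.ssubset_iff_of_subset ?_).2 ⟨j, ?_, ?_⟩))
  · intro a ha
    simp only [Finset.mem_filter, Finset.mem_univ, true_and] at ha ⊢
    obtain ⟨h1, h2, h3, h4⟩ := ha
    rw [hi] at h4
    have : δ a = δ' a := by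
      rcases hδ a with h5 | h5
      · exact h5
      · exact absurd h5.1 (not_le.2 h4)
    rw [← this, ← early i hl]
    exact ⟨h1, h2, h3, h4.trans hlt⟩
  · simp only [Finset.mem_filter, Finset.mem_univ, true_and]
    rw [← hjt]
    exact ⟨hj, hjU, htmem⟩
  · simp only [Finset.mem_filter, Finset.mem_univ, true_and]
    rintro ⟨-, -, -, h4⟩
    linarith

/-- A sweep is determined by the segments present at time zero, the birth ranks and the numbers of
kills. -/
theorem IsSweep.eq_of_ranks (h : IsSweep M U β δ) (h' : IsSweep M U β' δ')
    (hM : ∀ i j s t, M i j s → M i j t → s = t) (hU : ∀ i, (U i).OrdConnected)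
    (hβ0 : ∀ i, β i = 0 ↔ β' i = 0) (hδ0 : ∀ i, δ i = 0 ↔ δ' i = 0)
    (hr : ∀ i, birthRank M U β δ i = birthRank M U β' δ' i)
    (hw : ∀ i, killCount M U β δ i = killCount M U β' δ' i) : β = β' ∧ δ = δ' := by
  classical
  have nn : ∀ {β δ : ι → ℝ}, IsSweep M U β δ → ∀ i, 0 ≤ δ i := fun hs i => by
    rcases hs.lt_or_absent i with h1 | h1
    · exact (hs.nonneg i).trans h1.le
    · exact h1.2.ge
  -- The times of disagreement. The least one is positive, because the births and the deaths at time
  -- zero are prescribed.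
  let D : Finset ℝ := ((Finset.univ.filter fun i => β i ≠ β' i).image fun i => min (β i) (β' i)) ∪
    ((Finset.univ.filter fun i => δ i ≠ δ' i).image fun i => min (δ i) (δ' i))
  by_cases hD : D.Nonempty
  · exfalso
    set t := D.min' hD with ht_def
    have hle : ∀ s ∈ D, t ≤ s := fun s hs => D.min'_le s hs
    have hβ : ∀ i, β i = β' i ∨ (t ≤ β i ∧ t ≤ β' i) := fun i => by
      by_cases hi : β i = β' i
      · exact Or.inl hi
      · exact Or.inr (le_min_iff.1 (hle _ (Finset.mem_union_left _ (Finset.mem_image_of_mem _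
          (Finset.mem_filter.2 ⟨Finset.mem_univ i, hi⟩)))))
    have hδ : ∀ i, δ i = δ' i ∨ (t ≤ δ i ∧ t ≤ δ' i) := fun i => by
      by_cases hi : δ i = δ' i
      · exact Or.inl hi
      · exact Or.inr (le_min_iff.1 (hle _ (Finset.mem_union_right _ (Finset.mem_image_of_mem _
          (Finset.mem_filter.2 ⟨Finset.mem_univ i, hi⟩)))))
    have hβ' := fun i => (hβ i).imp Eq.symm And.symm
    have hδ' := fun i => (hδ i).imp Eq.symm And.symm
    have htD : t ∈ D := D.min'_mem hD
    rcases Finset.mem_union.1 htD with h1 | h1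
    · obtain ⟨i, hi, hit⟩ := Finset.mem_image.1 h1
      have hne := (Finset.mem_filter.1 hi).2
      have hpos : 0 < t := by
        rw [← hit]
        have h0 : β i ≠ 0 := fun h0 => hne (h0.trans ((hβ0 i).1 h0).symm)
        exact lt_min ((h.nonneg i).lt_of_ne' h0)
          ((h'.nonneg i).lt_of_ne' fun h2 => h0 ((hβ0 i).2 h2))
      rcases hne.lt_or_gt with h2 | h2
      · rw [min_eq_left h2.le] at hit
        exact h.birth_not_lt h' hM hU hpos hβ hδ (hr i) hit (hit ▸ h2)
      · rw [min_eq_right h2.le] at hit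
        exact h'.birth_not_lt h hM hU hpos hβ' hδ' (hr i).symm hit (hit ▸ h2)
    · obtain ⟨i, hi, hit⟩ := Finset.mem_image.1 h1
      have hne := (Finset.mem_filter.1 hi).2
      have hpos : 0 < t := by
        rw [← hit]
        have h0 : δ i ≠ 0 := fun h0 => hne (h0.trans ((hδ0 i).1 h0).symm)
        exact lt_min ((nn h i).lt_of_ne' h0)
          ((nn h' i).lt_of_ne' fun h2 => h0 ((hδ0 i).2 h2))
      rcases hne.lt_or_gt with h2 | h2
      · rw [min_eq_left h2.le] at hit
        exact h.death_not_lt h' hpos hβ hδ (hw i) hit (hit ▸ h2)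
      · rw [min_eq_right h2.le] at hit
        exact h'.death_not_lt h hpos hβ' hδ' (hw i).symm hit (hit ▸ h2)
  · have h0 : D = ∅ := Finset.not_nonempty_iff_eq_empty.1 hD
    have h1 := Finset.union_eq_empty.1 h0
    constructor <;> funext i <;> by_contra hne
    · exact Finset.notMem_empty _ (h1.1 ▸ Finset.mem_image_of_mem _
          (Finset.mem_filter.2 ⟨Finset.mem_univ i, hne⟩))
    · exact Finset.notMem_empty _ (h1.2 ▸ Finset.mem_image_of_mem _
          (Finset.mem_filter.2 ⟨Finset.mem_univ i, hne⟩))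

end Sweep

/-! ### Points, lines and segments in coordinates -/

/-- The coordinate of a point along the normal of a line. -/
noncomputable def normalCoord (l : LineParam) (x : Plane) : ℝ :=
  x 0 * Real.cos l.1 + x 1 * Real.sin l.1

/-- The abscissa of the projection of a point on a line. -/
noncomputable def tangentCoord (l : LineParam) (x : Plane) : ℝ :=
  x 1 * Real.cos l.1 - x 0 * Real.sin l.1

/-- The point `x` belongs to the line `l`. -/
def OnLine (l : LineParam) (x : Plane) : Prop := normalCoord l x = l.2

theorem linePoint_eq_iff {l : LineParam} {t : ℝ} {x : Plane} :
    linePoint l t = x ↔ OnLine l x ∧ tangentCoord l x = t := by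
  have h1 := Real.sin_sq_add_cos_sq l.1
  unfold OnLine normalCoord tangentCoord linePoint
  constructor
  · rintro rfl
    simp only [Matrix.cons_val_zero, Matrix.cons_val_one, Matrix.cons_val_fin_one]
    constructor
    · linear_combination l.2 * h1
    · linear_combination t * h1
  · rintro ⟨h2, rfl⟩
    ext i
    fin_cases i
    · simp only [Fin.zero_eta, Matrix.cons_val_zero]
      rw [← h2]
      linear_combination x 0 * h1
    · simp only [Fin.mk_one, Matrix.cons_val_one, Matrix.cons_val_fin_one]
      rw [← h2]
      linear_combination x 1 * h1

theorem onLine_linePoint (l : LineParam) (t : ℝ) : OnLine l (linePoint l t) :=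
  (linePoint_eq_iff.1 rfl).1

theorem tangentCoord_linePoint (l : LineParam) (t : ℝ) : tangentCoord l (linePoint l t) = t :=
  (linePoint_eq_iff.1 rfl).2

theorem OnLine.linePoint_tangentCoord {l : LineParam} {x : Plane} (h : OnLine l x) :
    linePoint l (tangentCoord l x) = x :=
  linePoint_eq_iff.2 ⟨h, rfl⟩

theorem mem_image_linePoint {l : LineParam} {A : Set ℝ} {x : Plane} :
    x ∈ linePoint l '' A ↔ OnLine l x ∧ tangentCoord l x ∈ A := by
  simp only [Set.mem_image, linePoint_eq_iff]
  constructor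
  · rintro ⟨t, ht, h, rfl⟩
    exact ⟨h, ht⟩
  · rintro ⟨h, ht⟩
    exact ⟨_, ht, h, rfl⟩

theorem SegParam.mem_carrier {s : SegParam} {x : Plane} :
    x ∈ s.carrier ↔ OnLine s.1 x ∧ tangentCoord s.1 x ∈ Set.Icc s.2.1 s.2.2 :=
  mem_image_linePoint

theorem SegParam.mem_inside {s : SegParam} {x : Plane} :
    x ∈ s.inside ↔ OnLine s.1 x ∧ tangentCoord s.1 x ∈ Set.Ioo s.2.1 s.2.2 :=
  mem_image_linePoint

theorem SegParam.mem_ends {s : SegParam} {x : Plane} :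
    x ∈ s.ends ↔ OnLine s.1 x ∧ (tangentCoord s.1 x = s.2.1 ∨ tangentCoord s.1 x = s.2.2) := by
  simp only [SegParam.ends, Set.mem_insert_iff, Set.mem_singleton_iff, eq_comm (a := x),
    linePoint_eq_iff]
  tauto

theorem SegParam.notMem_ends_of_mem_inside {s : SegParam} {x : Plane} (h : x ∈ s.inside) :
    x ∉ s.ends := fun h' => by
  rw [SegParam.mem_inside] at h
  rcases (SegParam.mem_ends.1 h').2 with h1 | h1
  · exact h.2.1.ne' h1
  · exact h.2.2.ne h1

theorem linePoint_segment (l : LineParam) (a b u v : ℝ) (h : u + v = 1) :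
    linePoint l (u * a + v * b) = u • linePoint l a + v • linePoint l b := by
  ext i
  fin_cases i
  · simp [linePoint]
    linear_combination (-l.2 * Real.cos l.1) * h
  · simp [linePoint]
    linear_combination (-l.2 * Real.sin l.1) * h

theorem convex_linePoint_preimage (l : LineParam) {V : Set Plane} (hV : Convex ℝ V) :
    Convex ℝ (linePoint l ⁻¹' V) := fun a ha b hb u v hu hv huv => by
  simp only [Set.mem_preimage, smul_eq_mul] at *
  rw [linePoint_segment l a b u v huv]
  exact hV ha hb hu hv huv

theorem continuous_linePoint_uncurry : Continuous fun q : LineParam × ℝ => linePoint q.1 q.2 := by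
  unfold linePoint
  refine (PiLp.continuous_toLp 2 _).comp (continuous_pi fun i => ?_)
  fin_cases i <;> simp <;> fun_prop

theorem sin_sub_eq_zero_iff {a b : ℝ} (ha : a ∈ Set.Ico 0 Real.pi) (hb : b ∈ Set.Ico 0 Real.pi) :
    Real.sin (a - b) = 0 ↔ a = b := by
  rw [Real.sin_eq_zero_iff_of_lt_of_lt (by linarith [ha.1, hb.2]) (by linarith [ha.2, hb.1]),
    sub_eq_zero]

/-- The abscissa on the line `l` of its intersection with the line `m`. -/
noncomputable def crossAbscissa (l m : LineParam) : ℝ :=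
  (l.2 * Real.cos (l.1 - m.1) - m.2) / Real.sin (l.1 - m.1)

theorem normalCoord_linePoint (l m : LineParam) (t : ℝ) :
    normalCoord m (linePoint l t) =
      l.2 * Real.cos (l.1 - m.1) - t * Real.sin (l.1 - m.1) := by
  simp only [normalCoord, linePoint, PiLp.toLp_apply, Matrix.cons_val_zero, Matrix.cons_val_one,
    Matrix.cons_val_fin_one, Real.cos_sub, Real.sin_sub]
  ring

theorem tangentCoord_eq_crossAbscissa {l m : LineParam} (hl : l.1 ∈ Set.Ico 0 Real.pi)
    (hm : m.1 ∈ Set.Ico 0 Real.pi) (hne : l ≠ m) {x : Plane} (h : OnLine l x) (h' : OnLine m x) :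
    tangentCoord l x = crossAbscissa l m := by
  have h1 := normalCoord_linePoint l m (tangentCoord l x)
  rw [h.linePoint_tangentCoord, h'] at h1
  have h2 : Real.sin (l.1 - m.1) ≠ 0 := fun h0 => by
    have h3 := (sin_sub_eq_zero_iff hl hm).1 h0
    rw [h3, sub_self, Real.cos_zero, Real.sin_zero] at h1
    exact hne (Prod.ext h3 (by linarith))
  rw [crossAbscissa, eq_div_iff h2]
  linarith

theorem eq_of_onLine_of_ne {l m : LineParam} (hl : l.1 ∈ Set.Ico 0 Real.pi)
    (hm : m.1 ∈ Set.Ico 0 Real.pi) (hne : l ≠ m) {x y : Plane} (hx : OnLine l x)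
    (hx' : OnLine m x) (hy : OnLine l y) (hy' : OnLine m y) : x = y := by
  rw [← hx.linePoint_tangentCoord, ← hy.linePoint_tangentCoord,
    tangentCoord_eq_crossAbscissa hl hm hne hx hx', tangentCoord_eq_crossAbscissa hl hm hne hy hy']

/-! ### Tessellations as tuples of segments -/

theorem mem_points_ofTuple {α : Type*} {k : ℕ} {s : Fin k → α} {a : α} :
    a ∈ (FinConfig.ofTuple s).points ↔ ∃ i, s i = a := by
  simp [FinConfig.ofTuple]

/-- The values of the tuple `s` are the segments of a T-tessellation. -/
structure IsTess (W : Set Plane) {k : ℕ} (s : Fin k → SegParam) : Prop where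
  angle_mem : ∀ i, (s i).1.1 ∈ Set.Ico 0 Real.pi
  birth_lt_death : ∀ i, (s i).2.1 < (s i).2.2
  inside_subset : ∀ i, (s i).inside ⊆ interior W
  not_aligned : ∀ i j, (s i).1 = (s j).1 → s i = s j
  tShaped : ∀ x ∈ interior W, IsVertex (FinConfig.ofTuple s).points x →
    IsTShaped (FinConfig.ofTuple s).points x

/-- The T-tessellation whose segments are the values of a tuple. -/
noncomputable def IsTess.tess {W : Set Plane} {k : ℕ} {s : Fin k → SegParam} (h : IsTess W s) :
    TTessellation W where
  segments := (FinConfig.ofTuple s).points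
  angle_mem := by
    intro a ha
    obtain ⟨i, rfl⟩ := mem_points_ofTuple.1 ha
    exact h.angle_mem i
  birth_lt_death := by
    intro a ha
    obtain ⟨i, rfl⟩ := mem_points_ofTuple.1 ha
    exact h.birth_lt_death i
  inside_subset := by
    intro a ha
    obtain ⟨i, rfl⟩ := mem_points_ofTuple.1 ha
    exact h.inside_subset i
  not_aligned := by
    intro a ha b hb
    obtain ⟨i, rfl⟩ := mem_points_ofTuple.1 ha
    obtain ⟨j, rfl⟩ := mem_points_ofTuple.1 hb
    exact h.not_aligned i j
  tShaped := h.tShaped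

/-- The tuples of segments that form a T-tessellation and are supported by the lines of the tuple
`l`, in the same order. -/
def tessTuples (W : Set Plane) {k : ℕ} (l : Fin k → LineParam) : Set (Fin k → SegParam) :=
  {s | IsTess W s ∧ ∀ i, (s i).1 = l i}

theorem TTessellation.mem_points_lines {W : Set Plane} {T : TTessellation W} {l : LineParam} :
    l ∈ T.lines.points ↔ ∃ a ∈ T.segments, a.1 = l := by
  classical
  simp [TTessellation.lines]

theorem IsTess.lines_tess {W : Set Plane} {k : ℕ} {l : Fin k → LineParam} {s : Fin k → SegParam}
    (h : IsTess W s) (hl : ∀ i, (s i).1 = l i) : h.tess.lines = FinConfig.ofTuple l := by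
  ext x
  rw [TTessellation.mem_points_lines, mem_points_ofTuple]
  constructor
  · rintro ⟨a, ha, rfl⟩
    obtain ⟨i, rfl⟩ := mem_points_ofTuple.1 ha
    exact ⟨i, (hl i).symm⟩
  · rintro ⟨i, rfl⟩
    exact ⟨s i, mem_points_ofTuple.2 ⟨i, rfl⟩, hl i⟩

/-- A T-tessellation supported by the lines of a tuple is a tuple of segments. -/
noncomputable def tessTuplesEquiv (W : Set Plane) {k : ℕ} (l : Fin k → LineParam) :
    tessTuples W l ≃ {T : TTessellation W // T.lines = FinConfig.ofTuple l} :=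
  Equiv.ofBijective (fun s => ⟨s.2.1.tess, s.2.1.lines_tess s.2.2⟩) <| by
    constructor
    · rintro ⟨s, hs, hsl⟩ ⟨s', hs', hsl'⟩ h
      have h1 : (FinConfig.ofTuple s).points = (FinConfig.ofTuple s').points :=
        congrArg (fun T => T.1.segments) h
      ext1
      funext i
      have h2 : s i ∈ (FinConfig.ofTuple s').points := h1 ▸ mem_points_ofTuple.2 ⟨i, rfl⟩
      obtain ⟨j, hj⟩ := mem_points_ofTuple.1 h2
      change s i = s' i
      rw [← hj]
      refine hs'.not_aligned j i ?_
      rw [hj, hsl, hsl']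
    · rintro ⟨T, hT⟩
      have h2 : ∀ i, ∃ a ∈ T.segments, a.1 = l i := fun i => by
        rw [← TTessellation.mem_points_lines, hT]
        exact mem_points_ofTuple.2 ⟨i, rfl⟩
      choose s hsT hsl using h2
      have h3 : (FinConfig.ofTuple s).points = T.segments := by
        ext a
        rw [mem_points_ofTuple]
        constructor
        · rintro ⟨i, rfl⟩
          exact hsT i
        · intro ha
          have : a.1 ∈ T.lines.points := TTessellation.mem_points_lines.2 ⟨a, ha, rfl⟩
          rw [hT] at this
          obtain ⟨i, hi⟩ := mem_points_ofTuple.1 this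
          exact ⟨i, T.not_aligned _ (hsT i) _ ha ((hsl i).trans hi)⟩
      have hs : IsTess W s :=
        { angle_mem := fun i => T.angle_mem _ (hsT i)
          birth_lt_death := fun i => T.birth_lt_death _ (hsT i)
          inside_subset := fun i => T.inside_subset _ (hsT i)
          not_aligned := fun i j => T.not_aligned _ (hsT i) _ (hsT j)
          tShaped := by
            rw [h3]
            exact T.tShaped }
      exact ⟨⟨s, hs, hsl⟩, Subtype.ext (TTessellation.ext h3)⟩

/-! ### Local structure at the inner vertices -/

section Tuples

variable {W : Set Plane} {k : ℕ} {s : Fin k → SegParam}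

/-- An inner endpoint lies inside another segment. -/
theorem IsTess.exists_host (h : IsTess W s) {i : Fin k} {x : Plane} (hx : x ∈ (s i).ends)
    (hxW : x ∈ interior W) : ∃ j, s i ≠ s j ∧ x ∈ (s j).inside := by
  have hv : IsVertex (FinConfig.ofTuple s).points x :=
    Or.inl ⟨s i, mem_points_ofTuple.2 ⟨i, rfl⟩, hx⟩
  obtain ⟨m, ⟨hm, hxm⟩, -⟩ := (h.tShaped x hxW hv).1
  obtain ⟨j, rfl⟩ := mem_points_ofTuple.1 hm
  exact ⟨j, fun he => SegParam.notMem_ends_of_mem_inside hxm (he ▸ hx), hxm⟩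

theorem IsTess.host_unique (h : IsTess W s) {i i' j : Fin k} {x : Plane} (hx : x ∈ (s j).ends)
    (hxW : x ∈ interior W) (hi : x ∈ (s i).inside) (hi' : x ∈ (s i').inside) : s i = s i' := by
  have hv : IsVertex (FinConfig.ofTuple s).points x :=
    Or.inl ⟨s j, mem_points_ofTuple.2 ⟨j, rfl⟩, hx⟩
  exact (h.tShaped x hxW hv).1.unique ⟨mem_points_ofTuple.2 ⟨i, rfl⟩, hi⟩
    ⟨mem_points_ofTuple.2 ⟨i', rfl⟩, hi'⟩

theorem SegParam.mem_inside_or_ends {a : SegParam} {x : Plane} (h : x ∈ a.carrier) :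
    x ∈ a.inside ∨ x ∈ a.ends := by
  rw [SegParam.mem_carrier] at h
  rw [SegParam.mem_inside, SegParam.mem_ends]
  rcases h.2.1.eq_or_lt with h1 | h1
  · exact Or.inr ⟨h.1, Or.inl h1.symm⟩
  · rcases h.2.2.eq_or_lt with h2 | h2
    · exact Or.inr ⟨h.1, Or.inr h2⟩
    · exact Or.inl ⟨h.1, h1, h2⟩

/-- Where two segments meet, one of them ends inside the other. -/
theorem IsTess.meet (h : IsTess W s) {i j : Fin k} (hij : s i ≠ s j) {x : Plane}
    (hxW : x ∈ interior W) (hi : x ∈ (s i).carrier) (hj : x ∈ (s j).carrier) :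
    (x ∈ (s i).inside ∧ x ∈ (s j).ends) ∨ (x ∈ (s j).inside ∧ x ∈ (s i).ends) := by
  have mem : ∀ i, s i ∈ (FinConfig.ofTuple s).points := fun i =>
    mem_points_ofTuple.2 ⟨i, rfl⟩
  have hv : IsVertex (FinConfig.ofTuple s).points x := Or.inr ⟨s i, mem i, s j, mem j, hij, hi, hj⟩
  have ht := h.tShaped x hxW hv
  rcases SegParam.mem_inside_or_ends hi with h1 | h1 <;>
    rcases SegParam.mem_inside_or_ends hj with h2 | h2
  · exact absurd (ht.1.unique ⟨mem i, h1⟩ ⟨mem j, h2⟩) hij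
  · exact Or.inl ⟨h1, h2⟩
  · exact Or.inr ⟨h2, h1⟩
  · exact absurd (ht.2.unique ⟨mem i, h1⟩ ⟨mem j, h2⟩) hij

end Tuples

/-! ### The possible endpoints of segments -/

/-- The abscissa at which a line enters the interior of `W`. -/
noncomputable def entryAbscissa (W : Set Plane) (l : LineParam) : ℝ :=
  (⨅ t : ℝ, ⨅ _ : linePoint l t ∈ interior W, (t : EReal)).toReal

/-- The abscissa at which a line leaves the interior of `W`. -/
noncomputable def exitAbscissa (W : Set Plane) (l : LineParam) : ℝ :=
  (⨆ t : ℝ, ⨆ _ : linePoint l t ∈ interior W, (t : EReal)).toReal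

/-- The abscissas at which the line is in the interior form an interval that contains `(b, d)` but
not `b`, so `b` is its infimum. Taking the infimum in `EReal` avoids side conditions on emptiness
and boundedness. -/
theorem entryAbscissa_eq {W : Set Plane} (hW : Convex ℝ W) {l : LineParam} {b d : ℝ} (hbd : b < d)
    (hsub : linePoint l '' Set.Ioo b d ⊆ interior W) (hb : linePoint l b ∉ interior W) :
    entryAbscissa W l = b := by
  have hc := (convex_linePoint_preimage l hW.interior).ordConnected
  have : (⨅ t : ℝ, ⨅ _ : linePoint l t ∈ interior W, (t : EReal)) = b := by
    apply le_antisymm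
    · refine le_of_forall_gt_imp_ge_of_dense fun c hc => ?_
      obtain ⟨u, hu1, hu2⟩ := EReal.lt_iff_exists_real_btwn.1
        (lt_min hc (EReal.coe_lt_coe_iff.2 hbd))
      have hu : u ∈ Set.Ioo b d :=
        ⟨EReal.coe_lt_coe_iff.1 hu1, EReal.coe_lt_coe_iff.1 (hu2.trans_le (min_le_right _ _))⟩
      exact (iInf₂_le u (hsub ⟨u, hu, rfl⟩)).trans (hu2.le.trans (min_le_left _ _))
    · refine le_iInf₂ fun t ht => EReal.coe_le_coe_iff.2 (not_lt.1 fun htb => hb ?_)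
      obtain ⟨u, hu⟩ := exists_between hbd
      exact hc.out ht (hsub ⟨u, hu, rfl⟩) ⟨htb.le, hu.1.le⟩
  rw [entryAbscissa, this, EReal.toReal_coe]

theorem exitAbscissa_eq {W : Set Plane} (hW : Convex ℝ W) {l : LineParam} {b d : ℝ} (hbd : b < d)
    (hsub : linePoint l '' Set.Ioo b d ⊆ interior W) (hd : linePoint l d ∉ interior W) :
    exitAbscissa W l = d := by
  have hc := (convex_linePoint_preimage l hW.interior).ordConnected
  have : (⨆ t : ℝ, ⨆ _ : linePoint l t ∈ interior W, (t : EReal)) = d := by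
    apply le_antisymm
    · refine iSup₂_le fun t ht => EReal.coe_le_coe_iff.2 (not_lt.1 fun htb => hd ?_)
      obtain ⟨u, hu⟩ := exists_between hbd
      exact hc.out (hsub ⟨u, hu, rfl⟩) ht ⟨hu.2.le, htb.le⟩
    · refine le_of_forall_lt_imp_le_of_dense fun c hc => ?_
      obtain ⟨u, hu1, hu2⟩ := EReal.lt_iff_exists_real_btwn.1
        (max_lt hc (EReal.coe_lt_coe_iff.2 hbd))
      have hu : u ∈ Set.Ioo b d :=
        ⟨EReal.coe_lt_coe_iff.1 ((le_max_right _ _).trans_lt hu1), EReal.coe_lt_coe_iff.1 hu2⟩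
      exact ((le_max_left _ _).trans hu1.le).trans
        (le_iSup₂ (f := fun (t : ℝ) (_ : linePoint l t ∈ interior W) => (t : EReal)) u
          (hsub ⟨u, hu, rfl⟩))
  rw [exitAbscissa, this, EReal.toReal_coe]

/-- A segment on the line `l i` is coded by the lines on which it ends; `none` stands for the
boundary of `W`. -/
noncomputable def codedSegment (W : Set Plane) {k : ℕ} (l : Fin k → LineParam) (i : Fin k)
    (c : Option (Fin k) × Option (Fin k)) : SegParam :=
  (l i, c.1.elim (entryAbscissa W (l i)) fun j => crossAbscissa (l i) (l j),
    c.2.elim (exitAbscissa W (l i)) fun j => crossAbscissa (l i) (l j))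

/-- An end in the interior of `W` is T-shaped, hence inside another segment and on another line of
the tuple. An end that is not in the interior is where the line enters or leaves it. -/
theorem exists_codedSegment_eq {W : Set Plane} (hW : Convex ℝ W) {k : ℕ} {l : Fin k → LineParam}
    {s : Fin k → SegParam} (hs : s ∈ tessTuples W l) (i : Fin k) :
    ∃ c, codedSegment W l i c = s i := by
  obtain ⟨h, hl⟩ := hs
  have key : ∀ x ∈ (s i).ends, x ∈ interior W →
      ∃ j, tangentCoord (l i) x = crossAbscissa (l i) (l j) := fun x hx hxW => by
    obtain ⟨j, hj, hxj⟩ := h.exists_host hx hxW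
    refine ⟨j, ?_⟩
    rw [← hl, ← hl]
    exact tangentCoord_eq_crossAbscissa (h.angle_mem i) (h.angle_mem j)
      (fun he => hj (h.not_aligned i j he)) (SegParam.mem_ends.1 hx).1 (SegParam.mem_inside.1 hxj).1
  have hb : ∃ c : Option (Fin k),
      c.elim (entryAbscissa W (l i)) (fun j => crossAbscissa (l i) (l j)) = (s i).2.1 := by
    by_cases hx : linePoint (s i).1 (s i).2.1 ∈ interior W
    · obtain ⟨j, hj⟩ := key _ (Set.mem_insert _ _) hx
      refine ⟨some j, ?_⟩
      rw [← hl i, tangentCoord_linePoint, hl i] at hj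
      exact hj.symm
    · refine ⟨none, ?_⟩
      rw [← hl]
      exact entryAbscissa_eq hW (h.birth_lt_death i) (h.inside_subset i) hx
  have hd : ∃ c : Option (Fin k),
      c.elim (exitAbscissa W (l i)) (fun j => crossAbscissa (l i) (l j)) = (s i).2.2 := by
    by_cases hx : linePoint (s i).1 (s i).2.2 ∈ interior W
    · obtain ⟨j, hj⟩ := key _ (Set.mem_insert_of_mem _ rfl) hx
      refine ⟨some j, ?_⟩
      rw [← hl i, tangentCoord_linePoint, hl i] at hj
      exact hj.symm
    · refine ⟨none, ?_⟩
      rw [← hl]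
      exact exitAbscissa_eq hW (h.birth_lt_death i) (h.inside_subset i) hx
  obtain ⟨c, hc⟩ := hb
  obtain ⟨c', hc'⟩ := hd
  exact ⟨(c, c'), Prod.ext (hl i).symm (Prod.ext hc hc')⟩

/-! ### Measurability -/

theorem FinConfig.measurable_of_comp_ofTuple {α β : Type*} [MeasurableSpace α] [MeasurableSpace β]
    {f : FinConfig α → β} (h : ∀ k, Measurable fun x : Fin k → α => f (FinConfig.ofTuple x)) :
    Measurable f := fun _ hS => MeasurableSpace.measurableSet_iInf.2 fun k => h k hS

/-- The infimum is upper semicontinuous in the line: it is below `r` as soon as some point of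
abscissa less than `r` is in the interior, which is an open condition. -/
theorem measurable_entryAbscissa (W : Set Plane) : Measurable (entryAbscissa W) := by
  refine measurable_ereal_toReal.comp (measurable_of_Iio fun r => IsOpen.measurableSet ?_)
  have : (fun l : LineParam => ⨅ t : ℝ, ⨅ _ : linePoint l t ∈ interior W, (t : EReal)) ⁻¹' Set.Iio r =
      ⋃ t : ℝ, ⋃ _ : (t : EReal) < r, {l | linePoint l t ∈ interior W} := by
    ext l
    simp only [Set.mem_preimage, Set.mem_Iio, iInf_lt_iff, Set.mem_iUnion, Set.mem_ofPred_eq]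
    exact exists_congr fun t => by rw [exists_prop, exists_prop, and_comm]
  rw [this]
  exact isOpen_iUnion fun t => isOpen_iUnion fun _ => isOpen_interior.preimage
    (continuous_linePoint_uncurry.comp (by fun_prop : Continuous fun l : LineParam => (l, t)))

theorem measurable_exitAbscissa (W : Set Plane) : Measurable (exitAbscissa W) := by
  refine measurable_ereal_toReal.comp (measurable_of_Ioi fun r => IsOpen.measurableSet ?_)
  have : (fun l : LineParam => ⨆ t : ℝ, ⨆ _ : linePoint l t ∈ interior W, (t : EReal)) ⁻¹' Set.Ioi r =
      ⋃ t : ℝ, ⋃ _ : r < (t : EReal), {l | linePoint l t ∈ interior W} := by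
    ext l
    simp only [Set.mem_preimage, Set.mem_Ioi, lt_iSup_iff, Set.mem_iUnion, Set.mem_ofPred_eq]
    exact exists_congr fun t => by rw [exists_prop, exists_prop, and_comm]
  rw [this]
  exact isOpen_iUnion fun t => isOpen_iUnion fun _ => isOpen_interior.preimage
    (continuous_linePoint_uncurry.comp (by fun_prop : Continuous fun l : LineParam => (l, t)))

theorem measurable_crossAbscissa {α : Type*} [MeasurableSpace α] {f g : α → LineParam}
    (hf : Measurable f) (hg : Measurable g) : Measurable fun a => crossAbscissa (f a) (g a) := by
  unfold crossAbscissa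
  fun_prop

theorem measurable_codedSegment (W : Set Plane) {k : ℕ} (i : Fin k)
    (c : Option (Fin k) × Option (Fin k)) :
    Measurable fun l : Fin k → LineParam => codedSegment W l i c := by
  obtain ⟨c, d⟩ := c
  refine (measurable_pi_apply i).prodMk (Measurable.prodMk ?_ ?_)
  · cases c with
    | none => exact (measurable_entryAbscissa W).comp (measurable_pi_apply i)
    | some j => exact measurable_crossAbscissa (measurable_pi_apply i) (measurable_pi_apply j)
  · cases d with
    | none => exact (measurable_exitAbscissa W).comp (measurable_pi_apply i)
    | some j => exact measurable_crossAbscissa (measurable_pi_apply i) (measurable_pi_apply j)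

/-! ### Measurability of incidence -/

section

variable {α : Type*} [MeasurableSpace α] {f : α → SegParam} {x : α → Plane}

theorem measurable_linePoint {g : α → LineParam} {t : α → ℝ} (hg : Measurable g)
    (ht : Measurable t) : Measurable fun a => linePoint (g a) (t a) :=
  continuous_linePoint_uncurry.measurable.comp (hg.prodMk ht)

theorem measurable_plane_apply (hx : Measurable x) (i : Fin 2) : Measurable fun a => x a i :=
  (EuclideanSpace.proj (ι := Fin 2) (𝕜 := ℝ) i).continuous.measurable.comp hx

theorem measurable_normalCoord {g : α → LineParam} (hg : Measurable g) (hx : Measurable x) :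
    Measurable fun a => normalCoord (g a) (x a) := by
  have := measurable_plane_apply hx
  unfold normalCoord
  fun_prop

theorem measurable_tangentCoord {g : α → LineParam} (hg : Measurable g) (hx : Measurable x) :
    Measurable fun a => tangentCoord (g a) (x a) := by
  have := measurable_plane_apply hx
  unfold tangentCoord
  fun_prop

theorem measurableSet_onLine {g : α → LineParam} (hg : Measurable g) (hx : Measurable x) :
    MeasurableSet {a | OnLine (g a) (x a)} :=
  measurableSet_eq_fun (measurable_normalCoord hg hx) hg.snd

theorem measurableSet_mem_carrier (hf : Measurable f) (hx : Measurable x) :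
    MeasurableSet {a | x a ∈ (f a).carrier} := by
  have h1 := measurable_tangentCoord hf.fst hx
  simp only [SegParam.mem_carrier]
  exact (measurableSet_onLine hf.fst hx).inter
    ((measurableSet_le hf.snd.fst h1).inter (measurableSet_le h1 hf.snd.snd))

theorem measurableSet_mem_inside (hf : Measurable f) (hx : Measurable x) :
    MeasurableSet {a | x a ∈ (f a).inside} := by
  have h1 := measurable_tangentCoord hf.fst hx
  simp only [SegParam.mem_inside]
  exact (measurableSet_onLine hf.fst hx).inter
    ((measurableSet_lt hf.snd.fst h1).inter (measurableSet_lt h1 hf.snd.snd))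

theorem measurableSet_mem_ends (hf : Measurable f) (hx : Measurable x) :
    MeasurableSet {a | x a ∈ (f a).ends} := by
  have h1 := measurable_tangentCoord hf.fst hx
  simp only [SegParam.mem_ends]
  exact (measurableSet_onLine hf.fst hx).inter
    ((measurableSet_eq_fun h1 hf.snd.fst).union (measurableSet_eq_fun h1 hf.snd.snd))

end

theorem existsUnique_points_ofTuple {k : ℕ} {s : Fin k → SegParam} {P : SegParam → Prop} :
    (∃! m, m ∈ (FinConfig.ofTuple s).points ∧ P m) ↔ ∃ i, P (s i) ∧ ∀ j, P (s j) → s j = s i := by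
  simp only [ExistsUnique, mem_points_ofTuple]
  constructor
  · rintro ⟨_, ⟨⟨i, rfl⟩, h1⟩, h2⟩
    exact ⟨i, h1, fun j hj => h2 _ ⟨⟨j, rfl⟩, hj⟩⟩
  · rintro ⟨i, h1, h2⟩
    refine ⟨s i, ⟨⟨i, rfl⟩, h1⟩, ?_⟩
    rintro _ ⟨⟨j, rfl⟩, hj⟩
    exact h2 j hj

theorem measurable_isTShaped {k : ℕ} {x : (Fin k → SegParam) → Plane} (hx : Measurable x) :
    Measurable fun s : Fin k → SegParam => IsTShaped (FinConfig.ofTuple s).points (x s) := by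
  have key : ∀ P : SegParam → Plane → Prop,
      (∀ i, Measurable fun s : Fin k → SegParam => P (s i) (x s)) → Measurable
        fun s : Fin k → SegParam => ∃! m, m ∈ (FinConfig.ofTuple s).points ∧ P m (x s) := by
    intro P hP
    simp only [existsUnique_points_ofTuple]
    exact .exists fun i => (hP i).and (.forall fun j => (hP j).imp (measurableSet_setOfPred.1
      (measurableSet_eq_fun (measurable_pi_apply j) (measurable_pi_apply i))))
  exact (key (fun m y => y ∈ m.inside) fun i => measurableSet_setOfPred.1
    (measurableSet_mem_inside (measurable_pi_apply i) hx)).and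
    (key (fun m y => y ∈ m.ends) fun i => measurableSet_setOfPred.1
      (measurableSet_mem_ends (measurable_pi_apply i) hx))

/-- By convexity it is enough to test the rational abscissas, which are countably many. -/
theorem measurable_inside_subset {W : Set Plane} (hW : Convex ℝ W) :
    Measurable fun a : SegParam => a.inside ⊆ interior W := by
  have : (fun a : SegParam => a.inside ⊆ interior W) = fun a => ∀ q : ℚ,
      a.2.1 < (q : ℝ) → (q : ℝ) < a.2.2 → linePoint a.1 q ∈ interior W := by
    funext a
    apply propext
    constructor
    · intro h q h1 h2
      exact h ⟨q, ⟨h1, h2⟩, rfl⟩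
    · rintro h _ ⟨t, ⟨h1, h2⟩, rfl⟩
      obtain ⟨q, hq1, hq2⟩ := exists_rat_btwn h1
      obtain ⟨r, hr1, hr2⟩ := exists_rat_btwn h2
      exact (convex_linePoint_preimage a.1 hW.interior).ordConnected.out
        (h q hq1 (hq2.trans h2)) (h r (h1.trans hr1) hr2) ⟨hq2.le, hr1.le⟩
  rw [this]
  refine .forall fun q => .imp ?_ (.imp ?_ ?_)
  · exact measurableSet_setOfPred.1 (measurableSet_lt (by fun_prop) (by fun_prop))
  · exact measurableSet_setOfPred.1 (measurableSet_lt (by fun_prop) (by fun_prop))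
  · exact measurableSet_setOfPred.1
      (measurable_linePoint measurable_fst measurable_const isOpen_interior.measurableSet)

/-- The T-shape condition over all points becomes finitely many conditions at explicit candidates.
For parallel lines `crossAbscissa` has the default value of a division by zero. This is harmless: a
candidate is tested only if it belongs to both segments, and it is then a genuine vertex. -/
theorem isTess_iff {W : Set Plane} {k : ℕ} {s : Fin k → SegParam} :
    IsTess W s ↔ (∀ i, (s i).1.1 ∈ Set.Ico 0 Real.pi) ∧ (∀ i, (s i).2.1 < (s i).2.2) ∧
      (∀ i, (s i).inside ⊆ interior W) ∧ (∀ i j, (s i).1 = (s j).1 → s i = s j) ∧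
      (∀ i, linePoint (s i).1 (s i).2.1 ∈ interior W →
        IsTShaped (FinConfig.ofTuple s).points (linePoint (s i).1 (s i).2.1)) ∧
      (∀ i, linePoint (s i).1 (s i).2.2 ∈ interior W →
        IsTShaped (FinConfig.ofTuple s).points (linePoint (s i).1 (s i).2.2)) ∧
      ∀ i j, s i ≠ s j →
        linePoint (s i).1 (crossAbscissa (s i).1 (s j).1) ∈ interior W →
        linePoint (s i).1 (crossAbscissa (s i).1 (s j).1) ∈ (s i).carrier →
        linePoint (s i).1 (crossAbscissa (s i).1 (s j).1) ∈ (s j).carrier →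
        IsTShaped (FinConfig.ofTuple s).points
          (linePoint (s i).1 (crossAbscissa (s i).1 (s j).1)) := by
  have mem : ∀ i, s i ∈ (FinConfig.ofTuple s).points := fun i => mem_points_ofTuple.2 ⟨i, rfl⟩
  constructor
  · intro h
    exact ⟨h.angle_mem, h.birth_lt_death, h.inside_subset, h.not_aligned,
      fun i hi => h.tShaped _ hi (Or.inl ⟨_, mem i, Or.inl rfl⟩),
      fun i hi => h.tShaped _ hi (Or.inl ⟨_, mem i, Or.inr rfl⟩),
      fun i j hij hx hi hj => h.tShaped _ hx (Or.inr ⟨_, mem i, _, mem j, hij, hi, hj⟩)⟩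
  · rintro ⟨h1, h2, h3, h4, h5, h6, h7⟩
    refine ⟨h1, h2, h3, h4, fun x hx hv => ?_⟩
    rcases hv with ⟨a, ha, hxa⟩ | ⟨a, ha, b, hb, hab, hxa, hxb⟩
    · obtain ⟨i, rfl⟩ := mem_points_ofTuple.1 ha
      rcases hxa with rfl | rfl
      · exact h5 i hx
      · exact h6 i hx
    · obtain ⟨i, rfl⟩ := mem_points_ofTuple.1 ha
      obtain ⟨j, rfl⟩ := mem_points_ofTuple.1 hb
      have hi := (SegParam.mem_carrier.1 hxa).1
      have h8 := tangentCoord_eq_crossAbscissa (h1 i) (h1 j) (fun he => hab (h4 i j he)) hi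
        (SegParam.mem_carrier.1 hxb).1
      have h9 : linePoint (s i).1 (crossAbscissa (s i).1 (s j).1) = x := by
        rw [← h8, hi.linePoint_tangentCoord]
      have h10 := h7 i j hab
      rw [h9] at h10
      exact h10 hx hxa hxb

theorem measurable_isTess {W : Set Plane} (hW : Convex ℝ W) (k : ℕ) :
    Measurable fun s : Fin k → SegParam => IsTess W s := by
  have hp : ∀ i : Fin k, Measurable fun s : Fin k → SegParam => s i := measurable_pi_apply
  have heq : ∀ i j : Fin k, Measurable fun s : Fin k → SegParam => s i = s j := fun i j =>
    measurableSet_setOfPred.1 (measurableSet_eq_fun (hp i) (hp j))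
  have hint : ∀ {x : (Fin k → SegParam) → Plane}, Measurable x →
      Measurable fun s => x s ∈ interior W := fun hx =>
    measurableSet_setOfPred.1 (hx isOpen_interior.measurableSet)
  have hc : ∀ i j : Fin k, Measurable fun s : Fin k → SegParam =>
      linePoint (s i).1 (crossAbscissa (s i).1 (s j).1) := fun i j =>
    measurable_linePoint (hp i).fst (measurable_crossAbscissa (hp i).fst (hp j).fst)
  have hb : ∀ i : Fin k, Measurable fun s : Fin k → SegParam => linePoint (s i).1 (s i).2.1 :=
    fun i => measurable_linePoint (hp i).fst (hp i).snd.fst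
  have hd : ∀ i : Fin k, Measurable fun s : Fin k → SegParam => linePoint (s i).1 (s i).2.2 :=
    fun i => measurable_linePoint (hp i).fst (hp i).snd.snd
  simp only [isTess_iff]
  refine .and (.forall fun i => ?_) <| .and (.forall fun i => ?_) <| .and (.forall fun i => ?_) <|
    .and (.forall fun i => .forall fun j => ?_) <|
    .and (.forall fun i => (hint (hb i)).imp (measurable_isTShaped (hb i))) <|
    .and (.forall fun i => (hint (hd i)).imp (measurable_isTShaped (hd i))) <|
    .forall fun i => .forall fun j => (heq i j).not.imp <| (hint (hc i j)).imp <|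
      .imp ?_ <| .imp ?_ <| measurable_isTShaped (hc i j)
  · exact measurableSet_setOfPred.1 ((hp i).fst.fst measurableSet_Ico)
  · exact measurableSet_setOfPred.1 (measurableSet_lt (hp i).snd.fst (hp i).snd.snd)
  · exact (measurable_inside_subset hW).comp (hp i)
  · exact (measurableSet_setOfPred.1 (measurableSet_eq_fun (hp i).fst (hp j).fst)).imp (heq i j)
  · exact measurableSet_setOfPred.1 (measurableSet_mem_carrier (hp i) (hc i j))
  · exact measurableSet_setOfPred.1 (measurableSet_mem_carrier (hp j) (hc i j))

open Classical in
/-- A sum over a set in the image of a finite linear order, with each point counted at its least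
preimage. -/
theorem tsum_subset_range {β : Type*} {n : ℕ} (g : Fin n → β) {S : Set β} (hS : S ⊆ Set.range g)
    (F : β → ℝ≥0∞) :
    ∑' b : S, F b = ∑ c, if g c ∈ S ∧ ∀ c' < c, g c' ≠ g c then F (g c) else 0 := by
  let A : Set (Fin n) := {c | g c ∈ S ∧ ∀ c' < c, g c' ≠ g c}
  let e : A ≃ S := Equiv.ofBijective (fun c => ⟨g c.1, c.2.1⟩) <| by
    constructor
    · rintro ⟨c, hc⟩ ⟨d, hd⟩ h
      have h' : g c = g d := congrArg Subtype.val h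
      refine Subtype.ext ?_
      rcases lt_trichotomy c d with h1 | h1 | h1
      · exact absurd h' (hd.2 c h1)
      · exact h1
      · exact absurd h'.symm (hc.2 d h1)
    · rintro ⟨b, hb⟩
      have hne : (Finset.univ.filter fun c => g c = b).Nonempty := by
        obtain ⟨c, hc⟩ := hS hb
        exact ⟨c, by simpa using hc⟩
      set c := Finset.min' _ hne with hc_def
      have hc : g c = b := (Finset.mem_filter.1 (Finset.min'_mem _ hne)).2
      refine ⟨⟨c, hc ▸ hb, fun d hd he => ?_⟩, Subtype.ext hc⟩
      exact absurd (Finset.min'_le _ d (by simp [he, hc])) (not_le.2 hd)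
  calc ∑' b : S, F b = ∑' c : A, F (g c) := (e.tsum_eq fun b : S => F b).symm
    _ = ∑' c, A.indicator (fun c => F (g c)) c := tsum_subtype A fun c => F (g c)
    _ = _ := by
      rw [tsum_fintype]
      exact Finset.sum_congr rfl fun c _ => Set.indicator_apply _ _ _

theorem tessellationsOn_apply {W : Set Plane} {k : ℕ} (l : Fin k → LineParam)
    {B : Set (FinConfig SegParam)} (hB : MeasurableSet B) :
    tessellationsOn W (FinConfig.ofTuple l)
        ((fun T : TTessellation W => (⟨T.segments⟩ : FinConfig SegParam)) ⁻¹' B) =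
      ∑' s : tessTuples W l, B.indicator 1 (FinConfig.ofTuple s.1) := by
  have hA : MeasurableSet
      ((fun T : TTessellation W => (⟨T.segments⟩ : FinConfig SegParam)) ⁻¹' B) := ⟨B, hB, rfl⟩
  rw [tessellationsOn, Measure.sum_apply _ hA, ← (tessTuplesEquiv W l).tsum_eq]
  classical
  refine tsum_congr fun s => ?_
  rw [Measure.dirac_apply' _ hA, Set.indicator_apply, Set.indicator_apply]
  rfl

/-- The map that sends a finite set of lines to the counting measure on the tessellations supported
by these lines is measurable. -/
theorem measurable_tessellationsOn {W : Set Plane} (hW : Convex ℝ W) :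
    Measurable (tessellationsOn W) := by
  classical
  refine Measure.measurable_of_measurable_coe _ ?_
  rintro _ ⟨B, hB, rfl⟩
  refine FinConfig.measurable_of_comp_ofTuple fun k => ?_
  simp only [tessellationsOn_apply _ hB]
  -- The set of codes does not depend on the lines, so the sum over tessellations becomes a fixed
  -- finite sum of measurable functions. Several codes may give the same segments; the order on the
  -- codes selects the least one.
  let κ := Fin k → Option (Fin k) × Option (Fin k)
  let e := (Fintype.equivFin κ).symm
  let g : Fin (Fintype.card κ) → (Fin k → LineParam) → Fin k → SegParam :=
    fun c l i => codedSegment W l i (e c i)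
  have hg : ∀ c, Measurable (g c) := fun c =>
    measurable_pi_lambda _ fun i => measurable_codedSegment W i (e c i)
  have hsub : ∀ l : Fin k → LineParam, tessTuples W l ⊆ Set.range fun c => g c l := by
    intro l s hs
    choose c hc using exists_codedSegment_eq hW hs
    exact ⟨e.symm c, by funext i; simp [g, hc]⟩
  have hsum := fun l => tsum_subset_range (fun c => g c l) (hsub l)
    fun s => B.indicator (1 : FinConfig SegParam → ℝ≥0∞) (FinConfig.ofTuple s)
  simp only [hsum]
  refine Finset.measurable_sum _ fun c _ => Measurable.ite ?_ ?_ measurable_const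
  · refine measurableSet_setOfPred.2 (.and (.and ((measurable_isTess hW k).comp (hg c)) ?_) ?_)
    · exact .forall fun i => measurableSet_setOfPred.1 (measurableSet_eq_fun
        ((measurable_pi_apply i).comp (hg c)).fst (measurable_pi_apply i))
    · exact .forall fun c' => (measurable_const (a := c' < c)).imp (Measurable.not
        (measurableSet_setOfPred.1 (measurableSet_eq_fun (hg c') (hg c))))
  · exact (measurable_one.indicator hB).comp ((FinConfig.measurable_ofTuple k).comp (hg c))

/-! ### The sweep of a tessellation from a line -/

/-- The signed distance to the line `l`, multiplied by `ε`. -/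
noncomputable def sideCoord (ε : ℝ) (l : LineParam) (x : Plane) : ℝ := ε * (normalCoord l x - l.2)

/-- The smallest time in the closed segment `a`, when the half-plane on the side `ε` of the line `l`
is swept from `l`. -/
noncomputable def firstTime (ε : ℝ) (l : LineParam) (a : SegParam) : ℝ :=
  max 0 (min (sideCoord ε l (linePoint a.1 a.2.1)) (sideCoord ε l (linePoint a.1 a.2.2)))

/-- The largest time in the closed segment `a`, when the half-plane on the side `ε` of the line `l`
is swept from `l`. -/
noncomputable def lastTime (ε : ℝ) (l : LineParam) (a : SegParam) : ℝ :=
  max 0 (max (sideCoord ε l (linePoint a.1 a.2.1)) (sideCoord ε l (linePoint a.1 a.2.2)))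

/-- The lines `i` and `j` meet at time `t`. -/
def MeetAt (ε : ℝ) {k : ℕ} (l : Fin k → LineParam) (i₀ i j : Fin k) (t : ℝ) : Prop :=
  i ≠ j ∧ ∃ x, OnLine (l i) x ∧ OnLine (l j) x ∧ sideCoord ε (l i₀) x = t

/-- The times at which the line `i` is in the interior of `W`. -/
def innerTimes (W : Set Plane) (ε : ℝ) {k : ℕ} (l : Fin k → LineParam) (i₀ i : Fin k) : Set ℝ :=
  {t | ∃ x ∈ interior W, OnLine (l i) x ∧ sideCoord ε (l i₀) x = t}

/-- A strictly monotone function maps an interval, its interior and its ends to those of the interval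
between the values at the ends. -/
theorem mem_iff_of_strictMono_or_strictAnti {f : ℝ → ℝ} (hf : StrictMono f ∨ StrictAnti f) {b d : ℝ}
    (hbd : b < d) (t : ℝ) :
    (t ∈ Set.Icc b d ↔ f t ∈ Set.Icc (min (f b) (f d)) (max (f b) (f d))) ∧
    (t ∈ Set.Ioo b d ↔ f t ∈ Set.Ioo (min (f b) (f d)) (max (f b) (f d))) ∧
    (t = b ∨ t = d ↔ f t = min (f b) (f d) ∨ f t = max (f b) (f d)) := by
  rcases hf with hf | hf
  · have h := hf hbd
    rw [min_eq_left h.le, max_eq_right h.le]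
    simp [hf.le_iff_le, hf.lt_iff_lt, hf.injective.eq_iff]
  · have h := hf hbd
    rw [min_eq_right h.le, max_eq_left h.le]
    simp [hf.le_iff_ge, hf.lt_iff_gt, hf.injective.eq_iff, and_comm, or_comm]

/-! ### Time as a coordinate on the lines -/

section Side

variable {ε : ℝ} {l m : LineParam}

theorem sideCoord_linePoint (t : ℝ) : sideCoord ε m (linePoint l t) =
    ε * (l.2 * Real.cos (l.1 - m.1) - t * Real.sin (l.1 - m.1) - m.2) := by
  rw [sideCoord, normalCoord_linePoint]

theorem OnLine.sideCoord_eq_zero {x : Plane} (h : OnLine l x) : sideCoord ε l x = 0 := by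
  rw [sideCoord, h, sub_self, mul_zero]

theorem sideCoord_neg (x : Plane) : sideCoord (-ε) l x = -sideCoord ε l x := by
  simp [sideCoord]

/-- Along `l` the time is affine in the abscissa, with slope `-ε * sin (l.1 - m.1)`. -/
theorem sideCoord_strictMono_or_strictAnti (hε : ε ≠ 0) (hl : Real.sin (l.1 - m.1) ≠ 0) :
    StrictMono (fun t => sideCoord ε m (linePoint l t)) ∨
      StrictAnti fun t => sideCoord ε m (linePoint l t) := by
  have h : ∀ a b, sideCoord ε m (linePoint l b) - sideCoord ε m (linePoint l a) =
      (ε * Real.sin (l.1 - m.1)) * (a - b) := fun a b => by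
    rw [sideCoord_linePoint, sideCoord_linePoint]
    ring
  rcases (mul_ne_zero hε hl).lt_or_gt with h0 | h0
  · exact Or.inl fun a b hab => sub_pos.1 (h a b ▸ mul_pos_of_neg_of_neg h0 (sub_neg.2 hab))
  · exact Or.inr fun a b hab => sub_neg.1 (h a b ▸ mul_neg_of_pos_of_neg h0 (sub_neg.2 hab))

theorem sideCoord_injective (hε : ε ≠ 0) (hl : Real.sin (l.1 - m.1) ≠ 0) :
    Function.Injective fun t => sideCoord ε m (linePoint l t) :=
  (sideCoord_strictMono_or_strictAnti hε hl).elim StrictMono.injective StrictAnti.injective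

theorem exists_sideCoord_eq (hε : ε ≠ 0) (hl : Real.sin (l.1 - m.1) ≠ 0) (u : ℝ) :
    ∃ t, sideCoord ε m (linePoint l t) = u := by
  refine ⟨(l.2 * Real.cos (l.1 - m.1) - m.2 - u / ε) / Real.sin (l.1 - m.1), ?_⟩
  rw [sideCoord_linePoint]
  field_simp
  ring

theorem convex_innerTimes {W : Set Plane} (hW : Convex ℝ W) {k : ℕ} (l : Fin k → LineParam)
    (i₀ i : Fin k) : Convex ℝ (innerTimes W ε l i₀ i) := by
  rintro _ ⟨x, hxW, hx, rfl⟩ _ ⟨y, hyW, hy, rfl⟩ u v hu hv huv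
  refine ⟨u • x + v • y, hW.interior hxW hyW hu hv huv, ?_, ?_⟩
  · simp only [OnLine, normalCoord, PiLp.add_apply, PiLp.smul_apply, smul_eq_mul] at hx hy ⊢
    linear_combination u * hx + v * hy + (l i).2 * huv
  · simp only [sideCoord, normalCoord, PiLp.add_apply, PiLp.smul_apply, smul_eq_mul]
    linear_combination (ε * (l i₀).2) * huv

variable {a : SegParam} {x : Plane}

theorem SegParam.mem_iff_sideCoord (hε : ε ≠ 0) (hl : Real.sin (a.1.1 - m.1) ≠ 0)
    (ha : a.2.1 < a.2.2) (hx : OnLine a.1 x) :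
    let p := sideCoord ε m (linePoint a.1 a.2.1)
    let q := sideCoord ε m (linePoint a.1 a.2.2)
    (x ∈ a.carrier ↔ sideCoord ε m x ∈ Set.Icc (min p q) (max p q)) ∧
    (x ∈ a.inside ↔ sideCoord ε m x ∈ Set.Ioo (min p q) (max p q)) ∧
    (x ∈ a.ends ↔ sideCoord ε m x = min p q ∨ sideCoord ε m x = max p q) := by
  have h := mem_iff_of_strictMono_or_strictAnti (sideCoord_strictMono_or_strictAnti hε hl) ha
    (tangentCoord a.1 x)
  simp only [hx.linePoint_tangentCoord] at h
  simpa only [SegParam.mem_carrier, SegParam.mem_inside, SegParam.mem_ends, hx, true_and] using h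

/-- On the swept side, membership in a segment can be read on the times. -/
theorem SegParam.mem_iff_times (hε : ε ≠ 0) (hl : Real.sin (a.1.1 - m.1) ≠ 0)
    (ha : a.2.1 < a.2.2) (hx : OnLine a.1 x) (h0 : 0 < sideCoord ε m x) :
    (x ∈ a.carrier ↔ sideCoord ε m x ∈ Set.Icc (firstTime ε m a) (lastTime ε m a)) ∧
    (x ∈ a.inside ↔ sideCoord ε m x ∈ Set.Ioo (firstTime ε m a) (lastTime ε m a)) ∧
    (x ∈ a.ends ↔ sideCoord ε m x = firstTime ε m a ∨ sideCoord ε m x = lastTime ε m a) := by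
  obtain ⟨h1, h2, h3⟩ := SegParam.mem_iff_sideCoord hε hl ha hx
  have aux : ∀ {t r : ℝ}, 0 < t → (t = max 0 r ↔ t = r) := fun {t r} ht => by
    rcases le_total 0 r with h | h
    · rw [max_eq_right h]
    · rw [max_eq_left h]
      constructor <;> intro h' <;> linarith
  rw [h1, h2, h3, firstTime, lastTime, aux h0, aux h0]
  simp only [Set.mem_Icc, Set.mem_Ioo, max_le_iff, max_lt_iff, le_max_iff, lt_max_iff, h0, h0.le,
    true_and, not_le.2 h0, not_lt.2 h0.le, false_or, and_self]

theorem firstTime_nonneg : 0 ≤ firstTime ε m a := le_max_left _ _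

/-- Clipping at zero gives both times the value `0` when the segment does not reach the open swept
side, which is the convention for absence in `IsSweep`. -/
theorem firstTime_lt_lastTime_or (hε : ε ≠ 0) (hl : Real.sin (a.1.1 - m.1) ≠ 0)
    (ha : a.2.1 < a.2.2) :
    firstTime ε m a < lastTime ε m a ∨ (firstTime ε m a = 0 ∧ lastTime ε m a = 0) := by
  have h : sideCoord ε m (linePoint a.1 a.2.1) ≠ sideCoord ε m (linePoint a.1 a.2.2) :=
    fun h => ha.ne (sideCoord_injective hε hl h)
  have h1 := min_lt_max.2 h
  unfold firstTime lastTime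
  rcases le_or_gt (max (sideCoord ε m (linePoint a.1 a.2.1))
    (sideCoord ε m (linePoint a.1 a.2.2))) 0 with h2 | h2
  · exact Or.inr ⟨max_eq_left (h1.le.trans h2), max_eq_left h2⟩
  · exact Or.inl (lt_max_of_lt_right (max_lt h2 h1))

theorem times_eq_zero (ha : a.1 = m) : firstTime ε m a = 0 ∧ lastTime ε m a = 0 := by
  subst ha
  simp [firstTime, lastTime, (onLine_linePoint a.1 _).sideCoord_eq_zero]

/-- A segment whose two parts, on the two sides of a line, are known is known. -/
theorem eq_of_times_eq {a' : SegParam} (h1 : a.1 = a'.1) (hl : Real.sin (a.1.1 - m.1) ≠ 0)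
    (ha : a.2.1 < a.2.2) (ha' : a'.2.1 < a'.2.2)
    (hf : ∀ ε : ℝ, ε = 1 ∨ ε = -1 → firstTime ε m a = firstTime ε m a')
    (hd : ∀ ε : ℝ, ε = 1 ∨ ε = -1 → lastTime ε m a = lastTime ε m a') : a = a' := by
  obtain ⟨n, b, d⟩ := a
  obtain ⟨n', b', d'⟩ := a'
  obtain rfl : n = n' := h1
  -- A real number is recovered from its positive and negative parts. Changing the sign of `ε`
  -- exchanges minimum and maximum, so the first time on one side is paired with the last time on
  -- the other.
  have key : ∀ r : ℝ, r = max 0 r - max 0 (-r) := fun r => by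
    rcases le_total 0 r with h | h
    · rw [max_eq_right h, max_eq_left (neg_nonpos.2 h), sub_zero]
    · rw [max_eq_left h, max_eq_right (neg_nonneg.2 h), zero_sub, neg_neg]
  have hf1 := hf 1 (Or.inl rfl)
  have hd1 := hd 1 (Or.inl rfl)
  have hf2 := hf (-1) (Or.inr rfl)
  have hd2 := hd (-1) (Or.inr rfl)
  simp only [firstTime, lastTime, sideCoord_neg, min_neg_neg, max_neg_neg] at hf1 hd1 hf2 hd2
  have hmin := (key _).trans ((congrArg₂ (· - ·) hf1 hd2).trans (key _).symm)
  have hmax := (key _).trans ((congrArg₂ (· - ·) hd1 hf2).trans (key _).symm)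
  rcases sideCoord_strictMono_or_strictAnti (m := m) (l := n) one_ne_zero hl with h | h
  · have e1 := h ha
    have e2 := h ha'
    simp only at e1 e2
    rw [min_eq_left e1.le, min_eq_left e2.le] at hmin
    rw [max_eq_right e1.le, max_eq_right e2.le] at hmax
    rw [h.injective hmin, h.injective hmax]
  · have e1 := h ha
    have e2 := h ha'
    simp only at e1 e2
    rw [min_eq_right e1.le, min_eq_right e2.le] at hmin
    rw [max_eq_left e1.le, max_eq_left e2.le] at hmax
    rw [h.injective hmin, h.injective hmax]

end Side

/-! ### From the vertices of a tessellation to the axioms of a sweep -/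

section Tess

variable {W : Set Plane} {ε : ℝ} {k : ℕ} {l : Fin k → LineParam} {s : Fin k → SegParam}

theorem sin_sub_ne_zero_of_ne (hs : s ∈ tessTuples W l)
    (hl : Function.Injective fun i => (l i).1) {i i₀ : Fin k} (hi : i ≠ i₀) :
    Real.sin ((s i).1.1 - (l i₀).1) ≠ 0 := fun h => by
  rw [← hs.2 i₀, sin_sub_eq_zero_iff (hs.1.angle_mem i) (hs.1.angle_mem i₀), hs.2, hs.2] at h
  exact hi (hl h)

theorem ne_of_sideCoord_pos {i i₀ : Fin k} {x : Plane} (hx : OnLine (l i) x)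
    (h0 : 0 < sideCoord ε (l i₀) x) : i ≠ i₀ := by
  rintro rfl
  exact h0.ne' hx.sideCoord_eq_zero

theorem eq_of_sideCoord_eq (hε : ε ≠ 0) (hs : s ∈ tessTuples W l)
    (hl : Function.Injective fun i => (l i).1) {i i₀ : Fin k} {x y : Plane} (hx : OnLine (l i) x)
    (hy : OnLine (l i) y) (h0 : 0 < sideCoord ε (l i₀) x)
    (h : sideCoord ε (l i₀) x = sideCoord ε (l i₀) y) : x = y := by
  have h1 := sin_sub_ne_zero_of_ne hs hl (ne_of_sideCoord_pos hx h0)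
  rw [hs.2] at h1
  rw [← hx.linePoint_tangentCoord, ← hy.linePoint_tangentCoord] at h
  rw [← hx.linePoint_tangentCoord, ← hy.linePoint_tangentCoord, sideCoord_injective hε h1 h]

theorem mem_iff_times (hε : ε ≠ 0) (hs : s ∈ tessTuples W l)
    (hl : Function.Injective fun i => (l i).1) {i i₀ : Fin k} {x : Plane} (hx : OnLine (l i) x)
    (h0 : 0 < sideCoord ε (l i₀) x) :
    (x ∈ (s i).carrier ↔
      sideCoord ε (l i₀) x ∈ Set.Icc (firstTime ε (l i₀) (s i)) (lastTime ε (l i₀) (s i))) ∧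
    (x ∈ (s i).inside ↔
      sideCoord ε (l i₀) x ∈ Set.Ioo (firstTime ε (l i₀) (s i)) (lastTime ε (l i₀) (s i))) ∧
    (x ∈ (s i).ends ↔
      sideCoord ε (l i₀) x = firstTime ε (l i₀) (s i) ∨
      sideCoord ε (l i₀) x = lastTime ε (l i₀) (s i)) :=
  SegParam.mem_iff_times hε (sin_sub_ne_zero_of_ne hs hl (ne_of_sideCoord_pos hx h0))
    (hs.1.birth_lt_death i) (hs.2 i ▸ hx) h0

theorem MeetAt.eq (hs : s ∈ tessTuples W l) (hl : Function.Injective fun i => (l i).1)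
    {i₀ i j : Fin k} {t u : ℝ} (ht : MeetAt ε l i₀ i j t) (hu : MeetAt ε l i₀ i j u) : t = u := by
  obtain ⟨hij, x, hx, hx', rfl⟩ := ht
  obtain ⟨-, y, hy, hy', rfl⟩ := hu
  rw [eq_of_onLine_of_ne (hs.2 i ▸ hs.1.angle_mem i) (hs.2 j ▸ hs.1.angle_mem j)
    (fun h => hij (hl (congrArg Prod.fst h))) hx hx' hy hy']

/-- A T-tessellation is swept from each of its lines. -/
theorem isSweep_of_mem_tessTuples (hε : ε ≠ 0) (hs : s ∈ tessTuples W l)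
    (hl : Function.Injective fun i => (l i).1) (i₀ : Fin k) :
    IsSweep (MeetAt ε l i₀) (innerTimes W ε l i₀) (fun i => firstTime ε (l i₀) (s i))
      fun i => lastTime ε (l i₀) (s i) := by
  have hinj : ∀ {i j}, s i = s j → i = j := fun {i j} h => hl (by
    change (l i).1 = (l j).1
    rw [← hs.2, ← hs.2, h])
  have host : ∀ {i x}, x ∈ interior W → OnLine (l i) x → 0 < sideCoord ε (l i₀) x →
      x ∈ (s i).ends → ∃ j, MeetAt ε l i₀ i j (sideCoord ε (l i₀) x) ∧ sideCoord ε (l i₀) x ∈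
        Set.Ioo (firstTime ε (l i₀) (s j)) (lastTime ε (l i₀) (s j)) := by
    intro i x hxW hx h0 hxe
    obtain ⟨j, hij, hj⟩ := hs.1.exists_host hxe hxW
    have hxj : OnLine (l j) x := hs.2 j ▸ (SegParam.mem_inside.1 hj).1
    exact ⟨j, ⟨fun h => hij (congrArg s h), x, hx, hxj, rfl⟩,
      (mem_iff_times hε hs hl hxj h0).2.1.1 hj⟩
  refine ⟨fun i => firstTime_nonneg, fun i => ?_, fun i t ht => ?_, ?_, ?_, ?_, ?_⟩
  · by_cases hi : i = i₀
    · exact Or.inr (times_eq_zero (hi ▸ hs.2 i))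
    · exact firstTime_lt_lastTime_or hε (sin_sub_ne_zero_of_ne hs hl hi) (hs.1.birth_lt_death i)
  · have h0 : 0 < t := firstTime_nonneg.trans_lt ht.1
    have hi : i ≠ i₀ := by
      rintro rfl
      have h1 := times_eq_zero (ε := ε) (hs.2 i)
      exact absurd (ht.1.trans ht.2) (by simp [h1])
    obtain ⟨u, rfl⟩ := exists_sideCoord_eq hε (sin_sub_ne_zero_of_ne hs hl hi) t
    have hx : OnLine (l i) (linePoint (s i).1 u) := hs.2 i ▸ onLine_linePoint (l i) u
    exact ⟨_, hs.1.inside_subset i ((mem_iff_times hε hs hl hx h0).2.1.2 ht), hx, rfl⟩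
  · rintro i j _ h0 ⟨hij, x, hx, hx', rfl⟩ ⟨y, hyW, hy, hyx⟩ hi hj
    obtain rfl := eq_of_sideCoord_eq hε hs hl hx hy h0 hyx.symm
    have h1 := mem_iff_times hε hs hl hx h0
    have h2 := mem_iff_times hε hs hl hx' h0
    have := hs.1.meet (fun h => hij (hinj h)) hyW (h1.1.2 hi) (h2.1.2 hj)
    rwa [h1.2.1, h1.2.2, h2.2.1, h2.2.2] at this
  · rintro i h0 ⟨x, hxW, hx, hxt⟩
    simp only [← hxt] at h0 ⊢
    exact host hxW hx h0 ((mem_iff_times hε hs hl hx h0).2.2.2 (Or.inl hxt))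
  · rintro i h0 ⟨x, hxW, hx, hxt⟩
    simp only [← hxt] at h0 ⊢
    exact host hxW hx h0 ((mem_iff_times hε hs hl hx h0).2.2.2 (Or.inr hxt))
  · rintro i i' j ⟨-, x, hx, hxj, hxt⟩ ⟨-, x', hx', hxj', hxt'⟩ ⟨y, hyW, hy, hyt⟩ hi hi'
    have h0 : 0 < sideCoord ε (l i₀) y := hyt ▸ firstTime_nonneg.trans_lt hi.1
    obtain rfl := eq_of_sideCoord_eq hε hs hl hy hxj h0 (hyt.trans hxt.symm)
    obtain rfl := eq_of_sideCoord_eq hε hs hl hy hxj' h0 (hyt.trans hxt'.symm)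
    rw [← hyt] at hi hi'
    exact hinj (hs.1.host_unique ((mem_iff_times hε hs hl hy h0).2.2.2 (Or.inr hyt)) hyW
      ((mem_iff_times hε hs hl hx h0).2.1.2 hi) ((mem_iff_times hε hs hl hx' h0).2.1.2 hi'))

end Tess

/-! ### Counting the tessellations on given lines -/

section Count

variable {W : Set Plane} {ε : ℝ} {k : ℕ} {l : Fin k → LineParam} {s : Fin k → SegParam}

/-- The birth rank of the segment `i` in the sweep from the line `i₀`. -/
noncomputable def tessRank (W : Set Plane) (ε : ℝ) (l : Fin k → LineParam) (i₀ : Fin k)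
    (s : Fin k → SegParam) : Fin k → ℕ :=
  birthRank (MeetAt ε l i₀) (innerTimes W ε l i₀) (fun i => firstTime ε (l i₀) (s i))
    fun i => lastTime ε (l i₀) (s i)

/-- The number of segments that die on the segment `i` in the sweep from the line `i₀`. -/
noncomputable def tessKill (W : Set Plane) (ε : ℝ) (l : Fin k → LineParam) (i₀ : Fin k)
    (s : Fin k → SegParam) : Fin k → ℕ :=
  killCount (MeetAt ε l i₀) (innerTimes W ε l i₀) (fun i => firstTime ε (l i₀) (s i))
    fun i => lastTime ε (l i₀) (s i)

open Classical in
/-- The segments met by the line `i`, other than the segment of this line. -/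
noncomputable def hitSegments (l : Fin k → LineParam) (s : Fin k → SegParam) (i : Fin k) :
    Finset (Fin k) :=
  Finset.univ.filter fun j => j ≠ i ∧ ∃ x ∈ (s j).carrier, OnLine (l i) x

theorem tessRank_le (hε : ε ≠ 0) (hs : s ∈ tessTuples W l)
    (hl : Function.Injective fun i => (l i).1) (i₀ i : Fin k) :
    tessRank W ε l i₀ s i ≤ (hitSegments l s i).card := by
  classical
  unfold tessRank birthRank hitSegments
  refine Finset.card_le_card fun j hj => ?_
  simp only [Finset.mem_filter, Finset.mem_univ, true_and] at hj ⊢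
  obtain ⟨_, ⟨h0, -⟩, ⟨hij, x, hx, hxj, rfl⟩, -, hj⟩ := hj
  exact ⟨hij.symm, x, (mem_iff_times hε hs hl hxj h0).1.2 hj, hx⟩

/-- Such a segment has a point at time zero, so its smallest unclipped time is not positive. These
are the segments that need no birth rank. -/
theorem firstTime_eq_zero_of_mem_hitSegments (hε : ε ≠ 0) (hs : s ∈ tessTuples W l)
    (hl : Function.Injective fun i => (l i).1) {i₀ j : Fin k} (hj : j ∈ hitSegments l s i₀) :
    firstTime ε (l i₀) (s j) = 0 := by
  simp only [hitSegments, Finset.mem_filter, Finset.mem_univ, true_and] at hj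
  obtain ⟨hne, x, hx, hx₀⟩ := hj
  have h := (SegParam.mem_iff_sideCoord hε (sin_sub_ne_zero_of_ne hs hl hne)
    (hs.1.birth_lt_death j) (SegParam.mem_carrier.1 hx).1).1.1 hx
  rw [hx₀.sideCoord_eq_zero] at h
  exact max_eq_left h.1

/-- A segment cannot lie strictly on both sides of a line; one birth rank per segment is therefore
enough for the two sweeps. -/
theorem firstTime_eq_zero_or {m : LineParam} {a : SegParam} :
    firstTime 1 m a = 0 ∨ firstTime (-1) m a = 0 := by
  simp only [firstTime, sideCoord_neg, min_neg_neg]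
  rcases le_total (min (sideCoord 1 m (linePoint a.1 a.2.1)) (sideCoord 1 m (linePoint a.1 a.2.2))) 0
    with h | h
  · exact Or.inl (max_eq_left h)
  · exact Or.inr (max_eq_left (neg_nonpos.2 (h.trans min_le_max)))

theorem sum_tessKill_le (hε : ε ≠ 0) (hs : s ∈ tessTuples W l)
    (hl : Function.Injective fun i => (l i).1) (i₀ : Fin k) : ∑ i, tessKill W ε l i₀ s i ≤ k :=
  (isSweep_of_mem_tessTuples hε hs hl i₀).sum_killCount_le.trans (Fintype.card_fin k).le

/-- A T-tessellation is determined by one of its segments and by the data of the two sweeps from the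
line that supports this segment. -/
theorem eq_of_mem_tessTuples (hW : Convex ℝ W) {s' : Fin k → SegParam} (hs : s ∈ tessTuples W l)
    (hs' : s' ∈ tessTuples W l) (hl : Function.Injective fun i => (l i).1) {i₀ : Fin k}
    (h₀ : s i₀ = s' i₀)
    (hf : ∀ ε : ℝ, ε = 1 ∨ ε = -1 → ∀ i,
      firstTime ε (l i₀) (s i) = 0 ↔ firstTime ε (l i₀) (s' i) = 0)
    (hd : ∀ ε : ℝ, ε = 1 ∨ ε = -1 → ∀ i,
      lastTime ε (l i₀) (s i) = 0 ↔ lastTime ε (l i₀) (s' i) = 0)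
    (hr : ∀ ε : ℝ, ε = 1 ∨ ε = -1 → ∀ i, firstTime ε (l i₀) (s i) ≠ 0 →
      tessRank W ε l i₀ s i = tessRank W ε l i₀ s' i)
    (hw : ∀ ε : ℝ, ε = 1 ∨ ε = -1 → ∀ i, tessKill W ε l i₀ s i = tessKill W ε l i₀ s' i) :
    s = s' := by
  have hW' : ∀ ε : ℝ, ε = 1 ∨ ε = -1 →
      ((fun i => firstTime ε (l i₀) (s i)) = fun i => firstTime ε (l i₀) (s' i)) ∧
      ((fun i => lastTime ε (l i₀) (s i)) = fun i => lastTime ε (l i₀) (s' i)) := by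
    intro ε hε
    have hε0 : ε ≠ 0 := by rcases hε with rfl | rfl <;> norm_num
    refine (isSweep_of_mem_tessTuples hε0 hs hl i₀).eq_of_ranks
      (isSweep_of_mem_tessTuples hε0 hs' hl i₀) (fun i j t u => MeetAt.eq hs hl) (fun i => ?_)
      (hf ε hε) (hd ε hε) (fun i => ?_) (hw ε hε)
    · exact (convex_innerTimes hW l i₀ i).ordConnected
    · by_cases h : firstTime ε (l i₀) (s i) = 0
      · rw [birthRank_eq_zero (by exact h), birthRank_eq_zero (by exact (hf ε hε i).1 h)]
      · exact hr ε hε i h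
  funext i
  by_cases hi : i = i₀
  · rw [hi, h₀]
  · exact eq_of_times_eq ((hs.2 i).trans (hs'.2 i).symm) (sin_sub_ne_zero_of_ne hs hl hi)
      (hs.1.birth_lt_death i) (hs'.1.birth_lt_death i)
      (fun ε hε => congrFun (hW' ε hε).1 i) (fun ε hε => congrFun (hW' ε hε).2 i)

/-- A bound on the number of words, by weights on the symbols. -/
theorem card_mul_le_pow {κ : Type*} [Fintype κ] (φ : κ → ℝ) (hφ : ∀ a, 0 ≤ φ a)
    (P : Finset (Fin k → κ)) (c : ℝ) (hP : ∀ f ∈ P, c ≤ ∏ i, φ (f i)) :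
    P.card * c ≤ (∑ a, φ a) ^ k := by
  classical
  rw [Fintype.sum_pow, ← nsmul_eq_mul]
  exact (Finset.card_nsmul_le_sum P _ c hP).trans (Finset.sum_le_sum_of_subset_of_nonneg
    (Finset.subset_univ P) fun f _ _ => Finset.prod_nonneg fun i _ => hφ _)

/-- The symbols used to code the births: whether the segment is absent on each side, and the side
and the birth rank when the segment does not meet the line from which the plane is swept. -/
abbrev BirthCode (m : ℕ) := Bool × Bool × Option (Bool × Fin (m + 1))

/-- The words for births in which at least `m` segments meet the line from which the plane is
swept. -/
def birthWords (k m : ℕ) : Finset (Fin k → BirthCode m) :=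
  Finset.univ.filter fun f => m ≤ (Finset.univ.filter fun i => (f i).2.2 = none).card

/-- The sequences of numbers of kills. -/
def killWords (k : ℕ) : Finset (Fin k → Fin (k + 1)) :=
  Finset.univ.filter fun f => ∑ i, (f i : ℕ) ≤ k

/-- The symbols without rank get weight `m + 1` and the others weight `1`. The four choices of the
two booleans give the total weight `4 * ((m + 1) + 2 * (m + 1))`, and each word weighs at least `(m
+ 1) ^ m`. -/
theorem card_birthWords_le (k m : ℕ) :
    ((birthWords k m).card : ℝ) * (m + 1) ^ m ≤ (12 * (m + 1)) ^ k := by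
  have h := card_mul_le_pow (k := k)
    (fun a : BirthCode m => if a.2.2 = none then (m + 1 : ℝ) else 1)
    (fun a => by split_ifs <;> positivity) (birthWords k m) ((m + 1) ^ m) fun f hf => by
      rw [Finset.prod_ite, Finset.prod_const, Finset.prod_const_one, mul_one]
      exact pow_le_pow_right₀ (by linarith [Nat.cast_nonneg (α := ℝ) m])
        (Finset.mem_filter.1 hf).2
  refine h.trans_eq ?_
  congr 1
  simp [Fintype.sum_prod_type, Fintype.sum_option]
  ring

/-- With weight `2 ^ (-a)` on the symbol `a`, the total weight is at most `2` and each word weighs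
at least `2 ^ (-k)`. -/
theorem card_killWords_le (k : ℕ) : ((killWords k).card : ℝ) ≤ 4 ^ k := by
  have h := card_mul_le_pow (k := k) (fun a : Fin (k + 1) => (1 / 2 : ℝ) ^ (a : ℕ))
    (fun a => by positivity) (killWords k) ((1 / 2) ^ k) fun f hf => by
      rw [Finset.prod_pow_eq_pow_sum]
      exact pow_le_pow_of_le_one (by norm_num) (by norm_num) (Finset.mem_filter.1 hf).2
  have h2 : (∑ a : Fin (k + 1), (1 / 2 : ℝ) ^ (a : ℕ)) ≤ 2 := by
    rw [Fin.sum_univ_eq_sum_range fun i => (1 / 2 : ℝ) ^ i]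
    exact sum_geometric_two_le _
  have h3 : ((killWords k).card : ℝ) * (1 / 2) ^ k ≤ 2 ^ k :=
    h.trans (pow_le_pow_left₀ (by positivity) h2 k)
  calc ((killWords k).card : ℝ) = (killWords k).card * (1 / 2) ^ k * 2 ^ k := by
        rw [mul_assoc, ← mul_pow]; norm_num
    _ ≤ 2 ^ k * 2 ^ k := by gcongr
    _ = 4 ^ k := by rw [← mul_pow]; norm_num

open Classical in
/-- The symbol of the segment `i` in the word for the births. -/
noncomputable def birthCode (W : Set Plane) (m : ℕ) (l : Fin k → LineParam) (i₀ : Fin k)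
    (s : Fin k → SegParam) (i : Fin k) : BirthCode m :=
  (decide (lastTime 1 (l i₀) (s i) = 0), decide (lastTime (-1) (l i₀) (s i) = 0),
    if firstTime 1 (l i₀) (s i) ≠ 0 then some (true, Fin.ofNat (m + 1) (tessRank W 1 l i₀ s i))
    else if firstTime (-1) (l i₀) (s i) ≠ 0 then
      some (false, Fin.ofNat (m + 1) (tessRank W (-1) l i₀ s i))
    else none)

/-- The tuples of segments for which the line `i₀` meets exactly `m` segments, the largest number
for the lines of the tuple. -/
def tessTuplesMax (W : Set Plane) (l : Fin k → LineParam) (i₀ : Fin k) (m : ℕ) :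
    Set (Fin k → SegParam) :=
  {s ∈ tessTuples W l | (hitSegments l s i₀).card = m ∧ ∀ i, (hitSegments l s i).card ≤ m}

/-- The injective code consists of the two ends of the segment on `l i₀`, with `k + 1` choices for
each, a birth word common to both sides, and one kill word per side. -/
theorem ncard_tessTuplesMax_le (hW : Convex ℝ W) (hl : Function.Injective fun i => (l i).1)
    (i₀ : Fin k) (m : ℕ) : (tessTuplesMax W l i₀ m).ncard ≤
      (k + 1) ^ 2 * ((birthWords k m).card * ((killWords k).card * (killWords k).card)) := by
  classical
  have hc : ∀ s : Fin k → SegParam, ∃ c, s ∈ tessTuples W l → codedSegment W l i₀ c = s i₀ :=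
    fun s => by
      by_cases hs : s ∈ tessTuples W l
      · obtain ⟨c, hc⟩ := exists_codedSegment_eq hW hs i₀
        exact ⟨c, fun _ => hc⟩
      · exact ⟨(none, none), fun h => absurd h hs⟩
  choose c hc using hc
  let κ : ℝ → (Fin k → SegParam) → Fin k → Fin (k + 1) :=
    fun ε s i => Fin.ofNat (k + 1) (tessKill W ε l i₀ s i)
  have hκ : ∀ ε : ℝ, ε = 1 ∨ ε = -1 → ∀ s ∈ tessTuples W l, ∀ i,
      (κ ε s i : ℕ) = tessKill W ε l i₀ s i := fun ε hε s hs i => by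
    have hε0 : ε ≠ 0 := by rcases hε with rfl | rfl <;> norm_num
    exact Nat.mod_eq_of_lt (Nat.lt_succ_of_le ((Finset.single_le_sum
      (f := tessKill W ε l i₀ s) (fun _ _ => Nat.zero_le _) (Finset.mem_univ i)).trans
      (sum_tessKill_le hε0 hs hl i₀)))
  have hκ' : ∀ ε : ℝ, ε = 1 ∨ ε = -1 → ∀ s ∈ tessTuples W l, κ ε s ∈ killWords k :=
    fun ε hε s hs => by
    have hε0 : ε ≠ 0 := by rcases hε with rfl | rfl <;> norm_num
    simp only [killWords, Finset.mem_filter, Finset.mem_univ, true_and, hκ ε hε s hs]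
    exact sum_tessKill_le hε0 hs hl i₀
  let A : Finset ((Option (Fin k) × Option (Fin k)) × (Fin k → BirthCode m) ×
      (Fin k → Fin (k + 1)) × (Fin k → Fin (k + 1))) :=
    Finset.univ ×ˢ birthWords k m ×ˢ killWords k ×ˢ killWords k
  have hA : A.card =
      (k + 1) ^ 2 * ((birthWords k m).card * ((killWords k).card * (killWords k).card)) := by
    simp [A, Finset.card_product, sq]
  rw [← hA, ← Set.ncard_coe_finset]
  refine Set.ncard_le_ncard_of_injOn
    (fun s => (c s, birthCode W m l i₀ s, κ 1 s, κ (-1) s)) ?_ ?_ A.finite_toSet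
  · rintro s ⟨hs, hm, -⟩
    simp only [A, Finset.coe_product, Set.mem_prod, Finset.mem_coe, Finset.mem_univ, true_and]
    refine ⟨?_, hκ' 1 (Or.inl rfl) s hs, hκ' (-1) (Or.inr rfl) s hs⟩
    rw [birthWords, Finset.mem_filter]
    refine ⟨Finset.mem_univ _, hm.symm.le.trans (Finset.card_le_card fun j hj => ?_)⟩
    simp [birthCode, firstTime_eq_zero_of_mem_hitSegments one_ne_zero hs hl hj,
      firstTime_eq_zero_of_mem_hitSegments (neg_ne_zero.2 one_ne_zero) hs hl hj]
  · rintro s ⟨hs, -, hm⟩ s' ⟨hs', -, hm'⟩ heq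
    simp only [Prod.mk.injEq] at heq
    obtain ⟨h1, h2, h3, h4⟩ := heq
    have hrank : ∀ ε : ℝ, ε ≠ 0 → ∀ i, Fin.ofNat (m + 1) (tessRank W ε l i₀ s i) =
        Fin.ofNat (m + 1) (tessRank W ε l i₀ s' i) →
        tessRank W ε l i₀ s i = tessRank W ε l i₀ s' i := fun ε hε i h => by
      -- Reduction modulo `m + 1` loses nothing: by maximality of `i₀`, all ranks are at most `m`.
      have h5 := congrArg Fin.val h
      rwa [Fin.val_ofNat, Fin.val_ofNat,
        Nat.mod_eq_of_lt (Nat.lt_succ_of_le ((tessRank_le hε hs hl i₀ i).trans (hm i))),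
        Nat.mod_eq_of_lt (Nat.lt_succ_of_le ((tessRank_le hε hs' hl i₀ i).trans (hm' i)))] at h5
    have hcode := fun i => congrFun h2 i
    simp only [birthCode, Prod.mk.injEq, decide_eq_decide] at hcode
    have key : ∀ i, ((firstTime 1 (l i₀) (s i) = 0 ↔ firstTime 1 (l i₀) (s' i) = 0) ∧
        (firstTime (-1) (l i₀) (s i) = 0 ↔ firstTime (-1) (l i₀) (s' i) = 0)) ∧
        (firstTime 1 (l i₀) (s i) ≠ 0 → tessRank W 1 l i₀ s i = tessRank W 1 l i₀ s' i) ∧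
        (firstTime (-1) (l i₀) (s i) ≠ 0 →
          tessRank W (-1) l i₀ s i = tessRank W (-1) l i₀ s' i) := by
      intro i
      have h5 := (hcode i).2.2
      -- The symbol records one side only; on the other side the first time is zero.
      have h6 := firstTime_eq_zero_or (m := l i₀) (a := s i)
      have h7 := firstTime_eq_zero_or (m := l i₀) (a := s' i)
      have h8 := hrank 1 one_ne_zero i
      have h9 := hrank (-1) (neg_ne_zero.2 one_ne_zero) i
      split_ifs at h5 <;> simp_all
    refine eq_of_mem_tessTuples hW (i₀ := i₀) hs hs' hl ?_ ?_ ?_ ?_ ?_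
    · rw [← hc s hs, ← hc s' hs', h1]
    · rintro ε (rfl | rfl) i
      · exact (key i).1.1
      · exact (key i).1.2
    · rintro ε (rfl | rfl) i
      · exact (hcode i).1
      · exact (hcode i).2.1
    · rintro ε (rfl | rfl) i
      · exact (key i).2.1
      · exact (key i).2.2
    · rintro ε (rfl | rfl) i
      · rw [← hκ 1 (Or.inl rfl) s hs, ← hκ 1 (Or.inl rfl) s' hs', h3]
      · rw [← hκ (-1) (Or.inr rfl) s hs, ← hκ (-1) (Or.inr rfl) s' hs', h4]

theorem finite_tessTuples (hW : Convex ℝ W) (l : Fin k → LineParam) : (tessTuples W l).Finite := by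
  refine (Set.finite_range fun (c : Fin k → Option (Fin k) × Option (Fin k)) i =>
    codedSegment W l i (c i)).subset fun s hs => ?_
  choose c hc using exists_codedSegment_eq hW hs
  exact ⟨c, funext hc⟩

/-- The number of T-tessellations supported by `k` lines in general position. -/
theorem ncard_tessTuples_le (hW : Convex ℝ W) (hl : Function.Injective fun i => (l i).1) :
    ((tessTuples W l).ncard : ℝ) ≤
      ∑ m ∈ Finset.range (k + 1), (1536 * (m + 1) : ℝ) ^ k / (m + 1) ^ m := by
  classical
  -- Without lines there is no `i₀` to sweep from, but there is only the empty tuple.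
  rcases k.eq_zero_or_pos with rfl | hk
  · have h : (tessTuples W l).ncard ≤ 1 :=
      (Set.ncard_le_one_iff_subset_singleton (Set.toFinite _)).2
        ⟨Fin.elim0, fun s _ => Subsingleton.elim _ _⟩
    simpa using h
  have : Nonempty (Fin k) := ⟨⟨0, hk⟩⟩
  have hcover : tessTuples W l ⊆
      ⋃ p ∈ (Finset.univ : Finset (Fin k)) ×ˢ Finset.range (k + 1), tessTuplesMax W l p.1 p.2 := by
    intro s hs
    obtain ⟨i₀, hi₀⟩ := Finite.exists_max fun i => (hitSegments l s i).card
    refine Set.mem_biUnion (x := (i₀, (hitSegments l s i₀).card)) ?_ ⟨hs, rfl, hi₀⟩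
    have := Finset.card_le_univ (hitSegments l s i₀)
    rw [Fintype.card_fin] at this
    simpa using Nat.lt_succ_of_le this
  have hfin : ∀ i₀ m, (tessTuplesMax W l i₀ m).Finite := fun i₀ m =>
    (finite_tessTuples hW l).subset fun s hs => hs.1
  have h1 : (tessTuples W l).ncard ≤
      ∑ p ∈ (Finset.univ : Finset (Fin k)) ×ˢ Finset.range (k + 1),
        (tessTuplesMax W l p.1 p.2).ncard :=
    (Set.ncard_le_ncard hcover (Set.Finite.biUnion (Finset.finite_toSet _) fun p _ =>
      hfin p.1 p.2)).trans (Finset.set_ncard_biUnion_le _ _)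
  have h2 : ∀ (i₀ : Fin k) (m : ℕ), ((tessTuplesMax W l i₀ m).ncard : ℝ) ≤
      (k + 1) ^ 2 * (192 * (m + 1)) ^ k / (m + 1) ^ m := by
    intro i₀ m
    have h3 : ((tessTuplesMax W l i₀ m).ncard : ℝ) ≤ (k + 1) ^ 2 *
        ((birthWords k m).card * ((killWords k).card * (killWords k).card)) := by
      exact_mod_cast ncard_tessTuplesMax_le hW hl i₀ m
    rw [le_div_iff₀ (by positivity)]
    calc ((tessTuplesMax W l i₀ m).ncard : ℝ) * (m + 1) ^ m
        ≤ (k + 1) ^ 2 * ((birthWords k m).card * ((killWords k).card * (killWords k).card)) *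
          (m + 1) ^ m := by gcongr
      _ = (k + 1) ^ 2 * (((birthWords k m).card * (m + 1) ^ m) *
          ((killWords k).card * (killWords k).card)) := by ring
      _ ≤ (k + 1) ^ 2 * ((12 * (m + 1)) ^ k * (4 ^ k * 4 ^ k)) := by
          gcongr
          · exact card_birthWords_le k m
          · exact card_killWords_le k
          · exact card_killWords_le k
      _ = (k + 1) ^ 2 * (192 * (m + 1)) ^ k := by
          rw [← mul_pow, ← mul_pow]
          ring_nf
  -- The choice of `i₀` and of the ends of its segment is absorbed in an exponential: `192 = 12 * 4
  -- * 4` becomes `1536 = 8 * 192`.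
  have h4 : (k : ℝ) * (k + 1) ^ 2 ≤ 8 ^ k := by
    have h5 : (k : ℝ) + 1 ≤ 2 ^ k := by exact_mod_cast Nat.lt_two_pow_self (n := k)
    calc (k : ℝ) * (k + 1) ^ 2 ≤ 2 ^ k * (2 ^ k) ^ 2 := by
          gcongr
          linarith
      _ = 8 ^ k := by
          rw [← pow_succ', ← pow_mul, mul_comm k, pow_mul]
          norm_num
  calc ((tessTuples W l).ncard : ℝ)
      ≤ ∑ p ∈ (Finset.univ : Finset (Fin k)) ×ˢ Finset.range (k + 1),
        ((tessTuplesMax W l p.1 p.2).ncard : ℝ) := by exact_mod_cast h1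
    _ ≤ ∑ p ∈ (Finset.univ : Finset (Fin k)) ×ˢ Finset.range (k + 1),
        (k + 1) ^ 2 * (192 * (p.2 + 1) : ℝ) ^ k / (p.2 + 1) ^ p.2 :=
        Finset.sum_le_sum fun p _ => h2 p.1 p.2
    _ = ∑ m ∈ Finset.range (k + 1),
        k * (k + 1) ^ 2 * ((192 * (m + 1) : ℝ) ^ k / (m + 1) ^ m) := by
        rw [Finset.sum_product_right]
        refine Finset.sum_congr rfl fun m _ => ?_
        simp
        ring
    _ ≤ ∑ m ∈ Finset.range (k + 1), (1536 * (m + 1) : ℝ) ^ k / (m + 1) ^ m := by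
        refine Finset.sum_le_sum fun m _ => ?_
        calc _ ≤ 8 ^ k * ((192 * (m + 1) : ℝ) ^ k / (m + 1) ^ m) := by gcongr
          _ = _ := by
            rw [← mul_div_assoc, ← mul_pow]
            ring_nf

end Count

/-! ### The Gibbs measure -/

/-- The law of the angle has no atom, so two independent angles almost surely differ. The zero
measure is allowed because conditioning gives it when the conditioning set has measure zero or
infinity. -/
theorem ae_pi_fst_injective (μ : Measure LineParam) [IsZeroOrProbabilityMeasure μ]
    (hμ : μ ≪ volume) (k : ℕ) :
    ∀ᵐ l ∂Measure.pi fun _ : Fin k => μ, Function.Injective fun i => (l i).1 := by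
  rcases eq_zero_or_isProbabilityMeasure μ with rfl | hP
  · rcases k.eq_zero_or_pos with rfl | hk
    · exact Filter.Eventually.of_forall fun l => Function.injective_of_subsingleton _
    · have : Measure.pi (fun _ : Fin k => (0 : Measure LineParam)) = 0 := by
        rw [← Measure.measure_univ_eq_zero, Measure.pi_univ]
        exact Finset.prod_eq_zero (Finset.mem_univ ⟨0, hk⟩) (by simp)
      rw [this]
      simp
  · have hnull : ∀ a : ℝ, μ.map Prod.fst {a} = 0 := fun a => by
      rw [Measure.map_apply measurable_fst (measurableSet_singleton a)]
      refine hμ ?_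
      rw [show (Prod.fst ⁻¹' {a} : Set LineParam) = {a} ×ˢ Set.univ by ext; simp,
        Measure.volume_eq_prod, Measure.prod_prod]
      simp
    have hpair : ∀ i j : Fin k, i ≠ j →
        ∀ᵐ l ∂Measure.pi fun _ : Fin k => μ, (l i).1 ≠ (l j).1 := by
      intro i j hij
      have hind := (ProbabilityTheory.iIndepFun_pi (μ := fun _ : Fin k => μ)
        (X := fun _ => Prod.fst) fun _ => measurable_fst.aemeasurable).indepFun hij
      have hm : ∀ i : Fin k, Measurable fun l : Fin k → LineParam => (l i).1 := fun i =>
        (measurable_pi_apply i).fst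
      have hmap : ∀ i : Fin k, (Measure.pi fun _ : Fin k => μ).map (fun l => (l i).1) =
          μ.map Prod.fst := fun i => by
        conv_rhs => rw [← (measurePreserving_eval (fun _ : Fin k => μ) i).map_eq]
        exact (Measure.map_map measurable_fst (measurable_pi_apply i)).symm
      have h := (ProbabilityTheory.indepFun_iff_map_prod_eq_prod_map_map (hm i).aemeasurable
        (hm j).aemeasurable).1 hind
      rw [hmap, hmap] at h
      have hd : ((μ.map Prod.fst).prod (μ.map Prod.fst)) (Set.diagonal ℝ) = 0 := by
        rw [Measure.prod_apply measurableSet_diagonal]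
        have : ∀ a : ℝ, Prod.mk a ⁻¹' Set.diagonal ℝ = {a} := fun a => by ext; simp [eq_comm]
        simp [this, hnull]
      rw [← h, Measure.map_apply ((hm i).prodMk (hm j)) measurableSet_diagonal] at hd
      exact measure_eq_zero_iff_ae_notMem.1 hd
    have hall : ∀ᵐ l ∂Measure.pi fun _ : Fin k => μ, ∀ i j : Fin k, i ≠ j → (l i).1 ≠ (l j).1 :=
      ae_all_iff.2 fun i => ae_all_iff.2 fun j => by
        by_cases hij : i = j
        · exact Filter.Eventually.of_forall fun l h => absurd hij h
        · exact (hpair i j hij).mono fun l h _ => h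
    exact hall.mono fun l h i j hij => by_contra fun hne => h i j hne hij

theorem lintegral_tessellationsOn {W : Set Plane} {f : TTessellation W → ℝ≥0∞} (hf : Measurable f)
    (L : FinConfig LineParam) :
    ∫⁻ T, f T ∂tessellationsOn W L = ∑' T : {T : TTessellation W // T.lines = L}, f T := by
  rw [tessellationsOn, lintegral_sum_measure]
  exact tsum_congr fun T => lintegral_dirac' _ hf

theorem measurable_tsum_tessellations {W : Set Plane} (hW : Convex ℝ W)
    {f : TTessellation W → ℝ≥0∞} (hf : Measurable f) :
    Measurable fun L => ∑' T : {T : TTessellation W // T.lines = L}, f T := by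
  simp only [← lintegral_tessellationsOn hf]
  exact (Measure.measurable_lintegral hf).comp (measurable_tessellationsOn hW)

theorem gibbsMeasure_apply {W : Set Plane} (hW : Convex ℝ W) (τ : ℝ≥0) {H : TTessellation W → ℝ}
    (hH : Measurable H) {A : Set (TTessellation W)} (hA : MeasurableSet A) :
    gibbsMeasure W τ H A = ∫⁻ L, ∑' T : {T : TTessellation W // T.lines = L},
      A.indicator (fun T => ENNReal.ofReal (Real.exp (-H T))) T.1 ∂(poissonLines W τ) := by
  have hf : Measurable (A.indicator fun T => ENNReal.ofReal (Real.exp (-H T))) :=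
    hH.neg.exp.ennreal_ofReal.indicator hA
  rw [gibbsMeasure, withDensity_apply _ hA, ← lintegral_indicator hA, tessellationMeasure,
    Measure.lintegral_bind (measurable_tessellationsOn hW).aemeasurable hf.aemeasurable]
  exact lintegral_congr fun L => lintegral_tessellationsOn hf L

theorem card_lines_le {W : Set Plane} {k : ℕ} {l : Fin k → LineParam} {T : TTessellation W}
    (hT : T.lines = FinConfig.ofTuple l) : T.lines.points.card ≤ k := by
  rw [hT]
  exact (@Finset.card_image_le _ _ Finset.univ l fun a b => Classical.propDecidable (a = b)).trans
    (by simp)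

/-- The weight of the tessellations supported by `k` lines in general position. -/
theorem tsum_exp_neg_energy_le {W : Set Plane} (hW : Convex ℝ W) {C : ℝ} {H : TTessellation W → ℝ}
    (hC : ∀ T : TTessellation W, -C * (T.lines.points.card : ℝ) ≤ H T) {k : ℕ}
    {l : Fin k → LineParam} (hl : Function.Injective fun i => (l i).1) :
    ∑' T : {T : TTessellation W // T.lines = FinConfig.ofTuple l},
        ENNReal.ofReal (Real.exp (-H T)) ≤
      ENNReal.ofReal (Real.exp |C| ^ k *
        ∑ m ∈ Finset.range (k + 1), (1536 * (m + 1) : ℝ) ^ k / (m + 1) ^ m) := by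
  have h1 : ∀ T : {T : TTessellation W // T.lines = FinConfig.ofTuple l},
      ENNReal.ofReal (Real.exp (-H T)) ≤ ENNReal.ofReal (Real.exp |C| ^ k) * 1 := fun T => by
    rw [mul_one, ← Real.exp_nat_mul]
    refine ENNReal.ofReal_le_ofReal (Real.exp_le_exp.2 ?_)
    have h2 : (T.1.lines.points.card : ℝ) ≤ k := by exact_mod_cast card_lines_le T.2
    calc -H T ≤ C * T.1.lines.points.card := by linarith [hC T]
      _ ≤ |C| * T.1.lines.points.card := by gcongr; exact le_abs_self C
      _ ≤ |C| * k := by gcongr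
      _ = k * |C| := mul_comm _ _
  refine (ENNReal.tsum_le_tsum h1).trans ?_
  rw [ENNReal.tsum_mul_left, ← (tessTuplesEquiv W l).tsum_eq, ENNReal.tsum_set_one,
    ← (finite_tessTuples hW l).cast_ncard_eq, ENNReal.ofReal_mul (by positivity)]
  gcongr
  refine le_trans ?_ (ENNReal.ofReal_le_ofReal (ncard_tessTuples_le hW hl))
  simp

/-- Up to a constant the term is `(exp K / (m + 1)) ^ m`, whose base is eventually at most `1 / 2`.
-/
theorem summable_exp_div_pow (K : ℝ) :
    Summable fun m : ℕ => Real.exp (K * (m + 1)) / (m + 1 : ℝ) ^ m := by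
  have h : ∀ m : ℕ, Real.exp (K * (m + 1)) / (m + 1 : ℝ) ^ m =
      Real.exp K * (Real.exp K / (m + 1)) ^ m := fun m => by
    rw [mul_add, Real.exp_add, mul_comm K, Real.exp_nat_mul, mul_one, div_pow]
    ring
  simp only [h]
  refine Summable.mul_left _ (Summable.of_norm_bounded_eventually_nat summable_geometric_two ?_)
  filter_upwards [Filter.eventually_ge_atTop ⌈2 * Real.exp K⌉₊] with m hm
  have h1 : 2 * Real.exp K ≤ m := (Nat.le_ceil _).trans (by exact_mod_cast hm)
  rw [norm_pow, Real.norm_of_nonneg (by positivity)]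
  refine pow_le_pow_left₀ (by positivity) ?_ m
  rw [div_le_iff₀ (by positivity)]
  linarith

theorem lintegral_poissonLines_le {W : Set Plane} (τ : ℝ≥0) {F : FinConfig LineParam → ℝ≥0∞}
    (hF : Measurable F) {K : ℝ} (hK : 0 ≤ K)
    (hFK : ∀ k, ∀ l : Fin k → LineParam, Function.Injective (fun i => (l i).1) →
      F (FinConfig.ofTuple l) ≤ ENNReal.ofReal (K ^ k *
        ∑ m ∈ Finset.range (k + 1), (1536 * (m + 1) : ℝ) ^ k / (m + 1) ^ m)) :
    ∫⁻ L, F L ∂poissonLines W τ < ∞ := by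
  set R : ℝ := τ * K * 1536 with hR
  have hR0 : 0 ≤ R := by positivity
  have hterm : ∀ k : ℕ, ∫⁻ L, F L ∂(ProbabilityTheory.poissonMeasure τ {k} •
      (Measure.pi fun _ : Fin k => ProbabilityTheory.cond (volume : Measure LineParam)
        (hittingLines W)).map FinConfig.ofTuple) ≤
      ∑' m : ℕ, ENNReal.ofReal ((R * (m + 1)) ^ k / k.factorial / (m + 1) ^ m) := by
    intro k
    rw [lintegral_smul_measure, lintegral_map hF (FinConfig.measurable_ofTuple k)]
    have h1 := lintegral_mono_ae ((ae_pi_fst_injective _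
      (ProbabilityTheory.cond_absolutelyContinuous (μ := (volume : Measure LineParam))
        (s := hittingLines W)) k).mono fun l hl => hFK k l hl)
    have h2 : (Measure.pi fun _ : Fin k => ProbabilityTheory.cond (volume : Measure LineParam)
        (hittingLines W)) Set.univ ≤ 1 := by
      rw [Measure.pi_univ]
      exact Finset.prod_le_one' fun _ _ => prob_le_one
    have h3 : ProbabilityTheory.poissonMeasure τ {k} ≤
        ENNReal.ofReal ((τ : ℝ) ^ k / k.factorial) := by
      rw [ProbabilityTheory.poissonMeasure_singleton]
      refine ENNReal.ofReal_le_ofReal ?_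
      rw [mul_div_assoc]
      exact mul_le_of_le_one_left (by positivity) (Real.exp_le_one_iff.2 (by simp))
    rw [lintegral_const] at h1
    refine (mul_le_mul' h3 (h1.trans (mul_le_of_le_one_right' h2))).trans ?_
    rw [← ENNReal.ofReal_mul (by positivity), Finset.mul_sum, Finset.mul_sum,
      ENNReal.ofReal_sum_of_nonneg fun m _ => by positivity]
    -- Extending the sum from `m ≤ k` to all `m` allows the sums over `k` and `m` to be exchanged;
    -- the sum over `k` is then an exponential series.
    refine le_trans (Finset.sum_le_sum fun m _ => ENNReal.ofReal_le_ofReal (le_of_eq ?_))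
      (ENNReal.sum_le_tsum _)
    rw [hR]
    simp only [mul_pow]
    ring
  rw [poissonLines, lintegral_sum_measure]
  refine (ENNReal.tsum_le_tsum hterm).trans_lt ?_
  rw [ENNReal.tsum_comm]
  have hexp : ∀ m : ℕ, ∑' k : ℕ, ENNReal.ofReal ((R * (m + 1)) ^ k / k.factorial / (m + 1) ^ m) =
      ENNReal.ofReal (Real.exp (R * (m + 1)) / (m + 1) ^ m) := fun m => by
    have h := (NormedSpace.expSeries_div_hasSum_exp (R * (m + 1))).div_const ((m + 1 : ℝ) ^ m)
    rw [← ENNReal.ofReal_tsum_of_nonneg (fun k => by positivity) h.summable, h.tsum_eq,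
      Real.exp_eq_exp_ℝ]
  simp only [hexp]
  exact (summable_exp_div_pow R).tsum_ofReal_lt_top

theorem mainTheorem2 (W : Set Plane) (hW_convex : Convex ℝ W) (hW_bounded : Bornology.IsBounded W)
    (hW_int : (interior W).Nonempty) (C : ℝ) (H : TTessellation W → ℝ) (hH : Measurable H)
    (hC : ∀ T : TTessellation W, -C * (T.lines.points.card : ℝ) ≤ H T) (τ : ℝ≥0) :
    AEMeasurable (tessellationsOn W) (poissonLines W τ) ∧
      (∀ A : Set (TTessellation W), MeasurableSet A →
        gibbsMeasure W τ H A =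
          ∫⁻ L, ∑' T : {T : TTessellation W // T.lines = L},
            A.indicator (fun T => ENNReal.ofReal (Real.exp (-H T))) T.1 ∂(poissonLines W τ)) ∧
      IsFiniteMeasure (gibbsMeasure W τ H) := by
  refine ⟨(measurable_tessellationsOn hW_convex).aemeasurable,
    fun A hA => gibbsMeasure_apply hW_convex τ hH hA, ⟨?_⟩⟩
  rw [gibbsMeasure_apply hW_convex τ hH MeasurableSet.univ]
  simp only [Set.indicator_univ]
  exact lintegral_poissonLines_le τ
    (measurable_tsum_tessellations hW_convex hH.neg.exp.ennreal_ofReal) (Real.exp_pos |C|).le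
    fun k l hl => tsum_exp_neg_energy_le hW_convex hC hl
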